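/- Let $p\neq 2$ be a prime number, let $|\cdot|$ be the absolute value of $\mathbb{Q}_p$ with $|p|=p^{-1}$, and put $\omega=\lim_n|n!|^{1/n}=|p|^{1/(p-1)}$. Let $\Gamma_p:\mathbb{Z}_p\to\mathbb{Z}_p$ be Morita's $p$-adic Gamma function, i.e. the unique continuous function with $\Gamma_p(0)=1$, $\Gamma_p(x+1)=-x\,\Gamma_p(x)$ if $|x|=1$ and $\Gamma_p(x+1)=-\Gamma_p(x)$ if $|x|<1$. For $\rho\ge 0$ let $x_{0,\rho}$ be the point of the Berkovich affine line over $\mathbb{Q}_p$ given by $|f|(x_{0,\rho})=\sup_i|a_i|\rho^i$ for $f=\sum_i a_iT^i$ (and use the same formula, for $\rho<1$, for power series $f$ converging on the open unit disc). Then $\Gamma_p$ has a Taylor expansion $\Gamma_p^0(T)\in\mathbb{Q}_p[[T]]$ at $0$ (a power series converging to $\Gamma_p$ on a neighbourhood of $0$ in $\mathbb{Z}_p$), and it is a solution of a rank one differential equation $$Y'=g_0(T)\,Y,\qquad g_0\in\mathcal{O}(D^-(0,1)),$$ where $\mathcal{O}(D^-(0,1))$ is the ring of power series $\sum_i a_iT^i\in\mathbb{Q}_p[[T]]$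 with $|a_i|\rho^i\to 0$ for all $0\le\rho<1$. Let $\mathcal{F}$ be the differential module on $D^-(0,1)$ associated to this equation. For $0\le\rho<1$ let $\mathcal{R}^{\mathcal{F}}(x_{0,\rho})$ be the radius of the largest open disc, centered at $t$ and contained in the open unit disc over $\Omega$, on which $\mathcal{F}$ is trivial; here $\Omega/\mathbb{Q}_p$ is any complete valued field extension and $t\in\Omega$ any point over $x_{0,\rho}$ (i.e. $|f(t)|=|f|(x_{0,\rho})$ for all $f\in\mathbb{Q}_p[T]$). Put $r_0=|p|^{1/p}$ and $r_n=\omega^{1/(p^{n-1}(p-1))}$ for $n\ge 1$. Then, independently of the choice of $\Omega$ and $t$, $$\mathcal{R}^{\mathcal{F}}(x_{0,\rho})=\begin{cases}\omega|p|^{1/p}&\text{if }0\le\rho\le r_0,\\[2pt] \dfrac{\omega|p|^n}{\rho^{p^{n-1}(p-1)}}&\text{if }r_{n-1}\le\rho\le r_n,\ n\ge 1.\end{cases}$$ Moreover $|g_0|(x_{0,\rho})\le\rho^{-1}$ if $0<\rho\le r_0$, and $$|g_0|(x_{0,\rho})=\frac{\rho^{p^{n-1}(p-1)}}{|p|^n}\qquad\text{if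 }r_{n-1}\le\rho\le r_n,\ n\ge 1.$$ -/

import Mathlib

open Filter Topology PowerSeries

noncomputable section

namespace MoritaGamma

/-! ## Morita's `p`-adic Gamma function -/

/-- The values on the natural numbers:
`n ↦ (-1)^n * ∏_{0 ≤ i < n, p ∤ i} i`, with value `1` at `n = 0`. -/
def gammaNat (p : ℕ) [Fact p.Prime] (n : ℕ) : ℤ_[p] :=
  (-1) ^ n * ∏ i ∈ (Finset.range n).filter (fun i => ¬ p ∣ i), (i : ℤ_[p])

/-- Morita's Gamma function `Γ_p : ℤ_p → ℤ_p`, the continuous extension of `gammaNat`: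
`Γ_p(x)` is the limit of `gammaNat p n` when the natural number `n` tends `p`-adically to `x`.
For odd `p` the limit exists, and `Γ_p` is the unique continuous function with `Γ_p(0) = 1` and
the functional equation: see `isMorita_moritaGamma` and `IsMorita.eq` below. -/
def moritaGamma (p : ℕ) [Fact p.Prime] (x : ℤ_[p]) : ℤ_[p] :=
  limUnder (comap (Nat.cast : ℕ → ℤ_[p]) (𝓝 x)) (gammaNat p)

/-- The properties which characterize Morita's Gamma function. -/
structure IsMorita (p : ℕ) [Fact p.Prime] (Γ : ℤ_[p] → ℤ_[p]) : Prop where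
  continuous : Continuous Γ
  map_zero : Γ 0 = 1
  map_add_one_of_unit : ∀ x, ‖x‖ = 1 → Γ (x + 1) = -x * Γ x
  map_add_one_of_nonunit : ∀ x, ‖x‖ < 1 → Γ (x + 1) = -Γ x

section Gamma

variable (p : ℕ) [Fact p.Prime]

theorem norm_sub_le_max (x y : ℤ_[p]) : ‖x - y‖ ≤ max ‖x‖ ‖y‖ := by
  rw [sub_eq_add_neg, ← norm_neg y]
  exact PadicInt.nonarchimedean _ _

theorem gammaNat_zero : gammaNat p 0 = 1 := by simp [gammaNat]

theorem gammaNat_succ (n : ℕ) :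
    gammaNat p (n + 1) = (if p ∣ n then -1 else -(n : ℤ_[p])) * gammaNat p n := by
  unfold gammaNat
  rw [Finset.range_add_one, Finset.filter_insert]
  by_cases h : p ∣ n
  · rw [if_neg (not_not.2 h), if_pos h, pow_succ]; ring
  · rw [if_pos h, if_neg h, Finset.prod_insert (by simp), pow_succ]; ring

/-- Wilson's theorem modulo an odd prime power. -/
theorem prod_units_zmod (hp : p ≠ 2) (k : ℕ) :
    ∏ u : (ZMod (p ^ (k + 1)))ˣ, u = -1 := by
  classical
  have hpp : p.Prime := Fact.out
  have : ∏ x ∈ (Finset.univ : Finset (ZMod (p ^ (k + 1)))ˣ).erase (-1), x = 1 :=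
    Finset.prod_involution (fun x _ => x⁻¹) (by simp)
      (fun a ha h1 h2 => by
        have hsq : (a : ZMod (p ^ (k + 1))) ^ 2 = 1 := by
          have : a * a = 1 := by
            nth_rewrite 1 [← h2]; simp
          rw [sq, ← Units.val_mul, this, Units.val_one]
        have hne : a ≠ -1 := Finset.ne_of_mem_erase ha
        obtain ⟨z, hz⟩ := ZMod.intCast_surjective (a : ZMod (p ^ (k + 1)))
        have hdvd : ((p : ℤ) ^ (k + 1)) ∣ (z - 1) * (z + 1) := by
          have : ((((z - 1) * (z + 1) : ℤ)) : ZMod (p ^ (k + 1))) = 0 := by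
            push_cast
            rw [hz]
            linear_combination hsq
          have h3 := (ZMod.intCast_zmod_eq_zero_iff_dvd _ _).1 this
          exact_mod_cast h3
        have hprime : Prime (p : ℤ) := Nat.prime_iff_prime_int.1 hpp
        by_cases hd : (p : ℤ) ∣ z + 1
        · have hnd : ¬ (p : ℤ) ∣ z - 1 := by
            intro h
            have h2' : (p : ℤ) ∣ 2 := by
              have := dvd_sub hd h
              ring_nf at this
              exact this
            have := Int.le_of_dvd (by norm_num) h2'
            have := hpp.two_le
            omega
          have hcop : IsCoprime ((p : ℤ) ^ (k + 1)) (z - 1) :=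
            IsCoprime.pow_left ((Prime.coprime_iff_not_dvd hprime).2 hnd)
          have h4 := hcop.dvd_of_dvd_mul_left hdvd
          have : ((z + 1 : ℤ) : ZMod (p ^ (k + 1))) = 0 := by
            rw [ZMod.intCast_zmod_eq_zero_iff_dvd]
            exact_mod_cast h4
          apply hne
          ext
          push_cast at this
          rw [hz] at this
          simpa using eq_neg_of_add_eq_zero_left this
        · have hcop : IsCoprime ((p : ℤ) ^ (k + 1)) (z + 1) :=
            IsCoprime.pow_left ((Prime.coprime_iff_not_dvd hprime).2 hd)
          have h4 := hcop.dvd_of_dvd_mul_right hdvd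
          have : ((z - 1 : ℤ) : ZMod (p ^ (k + 1))) = 0 := by
            rw [ZMod.intCast_zmod_eq_zero_iff_dvd]
            exact_mod_cast h4
          apply h1
          ext
          push_cast at this
          rw [hz] at this
          simpa using sub_eq_zero.1 this)
      (fun a ha => by
        refine Finset.mem_erase.2 ⟨?_, Finset.mem_univ _⟩
        intro h
        apply Finset.ne_of_mem_erase ha
        rw [← inv_inv a, h]; simp)
      (by simp)
  rw [← Finset.insert_erase (Finset.mem_univ (-1 : (ZMod (p ^ (k + 1)))ˣ)),
    Finset.prod_insert (Finset.notMem_erase _ _), this, mul_one]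

theorem toZModPow_gammaNat_pow (hp : p ≠ 2) (k : ℕ) :
    PadicInt.toZModPow (k + 1) (gammaNat p (p ^ (k + 1))) = 1 := by
  have hpp : p.Prime := Fact.out
  have hodd : Odd (p ^ (k + 1)) := (hpp.odd_of_ne_two hp).pow
  have key : ∏ i ∈ (Finset.range (p ^ (k + 1))).filter (fun i => ¬ p ∣ i),
      (i : ZMod (p ^ (k + 1))) = -1 := by
    have h1 : ((∏ u : (ZMod (p ^ (k + 1)))ˣ, u : (ZMod (p ^ (k + 1)))ˣ) : ZMod (p ^ (k + 1)))
        = -1 := by rw [prod_units_zmod p hp k]; simp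
    rw [← h1, Units.coe_prod]
    symm
    refine Finset.prod_bij (fun u _ => (u : ZMod (p ^ (k + 1))).val) ?_ ?_ ?_ ?_
    · intro u _
      rw [Finset.mem_filter, Finset.mem_range]
      refine ⟨ZMod.val_lt _, ?_⟩
      have := ZMod.val_coe_unit_coprime u
      rw [Nat.coprime_pow_right_iff (Nat.succ_pos k)] at this
      exact (Nat.Prime.coprime_iff_not_dvd hpp).1 this.symm
    · intro u _ v _ h
      ext
      exact ZMod.val_injective _ h
    · intro i hi
      rw [Finset.mem_filter, Finset.mem_range] at hi
      have hc : Nat.Coprime i (p ^ (k + 1)) :=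
        (Nat.Coprime.pow_left _ ((Nat.Prime.coprime_iff_not_dvd hpp).2 hi.2)).symm
      exact ⟨ZMod.unitOfCoprime i hc, Finset.mem_univ _, by
        simp [ZMod.val_natCast, Nat.mod_eq_of_lt hi.1]⟩
    · intro u _
      simp
  unfold gammaNat
  rw [map_mul, map_pow, map_neg, map_one, map_prod]
  simp only [map_natCast]
  rw [key, hodd.neg_one_pow]
  ring

theorem toZModPow_gammaNat_add (hp : p ≠ 2) (k n : ℕ) :
    PadicInt.toZModPow (k + 1) (gammaNat p (n + p ^ (k + 1))) =
      PadicInt.toZModPow (k + 1) (gammaNat p n) := by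
  induction n with
  | zero => rw [zero_add, toZModPow_gammaNat_pow p hp, gammaNat_zero, map_one]
  | succ n ih =>
    have hd : p ∣ n + p ^ (k + 1) ↔ p ∣ n :=
      (Nat.dvd_add_iff_left (dvd_pow_self p (Nat.succ_ne_zero k))).symm
    rw [show n + 1 + p ^ (k + 1) = (n + p ^ (k + 1)) + 1 by ring, gammaNat_succ, gammaNat_succ,
      map_mul, map_mul, ih]
    congr 1
    simp only [hd]
    split_ifs
    · rfl
    · rw [map_neg, map_neg, map_natCast, map_natCast]
      push_cast
      rw [← Nat.cast_pow, ZMod.natCast_self, add_zero]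

theorem toZModPow_gammaNat_add_mul (hp : p ≠ 2) (k n j : ℕ) :
    PadicInt.toZModPow (k + 1) (gammaNat p (n + j * p ^ (k + 1))) =
      PadicInt.toZModPow (k + 1) (gammaNat p n) := by
  induction j with
  | zero => simp
  | succ j ih =>
    rw [show n + (j + 1) * p ^ (k + 1) = (n + j * p ^ (k + 1)) + p ^ (k + 1) by ring,
      toZModPow_gammaNat_add p hp, ih]

theorem norm_le_iff_toZModPow (x y : ℤ_[p]) (k : ℕ) :
    ‖x - y‖ ≤ (p : ℝ) ^ (-(k : ℤ)) ↔ PadicInt.toZModPow k x = PadicInt.toZModPow k y := by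
  rw [PadicInt.norm_le_pow_iff_mem_span_pow, ← PadicInt.ker_toZModPow, RingHom.mem_ker, map_sub,
    sub_eq_zero]

theorem gammaNat_dist (hp : p ≠ 2) (k n m : ℕ)
    (h : ‖(n : ℤ_[p]) - m‖ ≤ (p : ℝ) ^ (-((k + 1 : ℕ) : ℤ))) :
    ‖gammaNat p n - gammaNat p m‖ ≤ (p : ℝ) ^ (-((k + 1 : ℕ) : ℤ)) := by
  wlog hnm : m ≤ n generalizing n m
  · rw [norm_sub_rev]
    exact this m n (by rwa [norm_sub_rev]) (by omega)
  rw [norm_le_iff_toZModPow] at h ⊢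
  rw [map_natCast, map_natCast, ZMod.natCast_eq_natCast_iff] at h
  obtain ⟨j, hj⟩ := (Nat.modEq_iff_dvd' hnm).1 h.symm
  obtain rfl : n = m + j * p ^ (k + 1) := by
    rw [mul_comm, ← hj]; omega
  exact toZModPow_gammaNat_add_mul p hp k m j

instance comap_natCast_neBot (x : ℤ_[p]) : (comap (Nat.cast : ℕ → ℤ_[p]) (𝓝 x)).NeBot :=
  comap_neBot_iff_frequently.2 <| by
    have := PadicInt.denseRange_natCast (p := p) x
    exact (mem_closure_iff_frequently.1 this)

theorem eventually_comap (x : ℤ_[p]) (k : ℕ) :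
    ∀ᶠ n : ℕ in comap (Nat.cast : ℕ → ℤ_[p]) (𝓝 x), ‖(n : ℤ_[p]) - x‖ ≤ (p : ℝ) ^ (-(k : ℤ)) := by
  have hpp : p.Prime := Fact.out
  have hpos : (0 : ℝ) < (p : ℝ) ^ (-(k : ℤ)) := zpow_pos (by exact_mod_cast hpp.pos) _
  filter_upwards [preimage_mem_comap (Metric.closedBall_mem_nhds x hpos)] with n hn
  rwa [Set.mem_preimage, Metric.mem_closedBall, dist_eq_norm] at hn

theorem tendsto_gammaNat (hp : p ≠ 2) (x : ℤ_[p]) :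
    Tendsto (gammaNat p) (comap (Nat.cast : ℕ → ℤ_[p]) (𝓝 x)) (𝓝 (moritaGamma p x)) := by
  apply tendsto_nhds_limUnder
  apply cauchy_map_iff_exists_tendsto.1
  rw [Metric.cauchy_iff]
  refine ⟨inferInstance, fun ε hε => ?_⟩
  obtain ⟨k, hk⟩ := PadicInt.exists_pow_neg_lt p hε
  refine ⟨_, image_mem_map (eventually_comap p x (k + 1)), ?_⟩
  rintro _ ⟨n, hn, rfl⟩ _ ⟨m, hm, rfl⟩
  have hle : (p : ℝ) ^ (-((k + 1 : ℕ) : ℤ)) ≤ (p : ℝ) ^ (-(k : ℤ)) := by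
    apply zpow_le_zpow_right₀ (by exact_mod_cast (Fact.out : p.Prime).one_le)
    push_cast; omega
  refine lt_of_le_of_lt (le_trans ?_ hle) hk
  rw [dist_eq_norm]
  apply gammaNat_dist p hp
  have : (n : ℤ_[p]) - m = (n - x) - (m - x) := by ring
  rw [this]
  exact (norm_sub_le_max p _ _).trans (max_le hn hm)

theorem moritaGamma_dist (hp : p ≠ 2) (k : ℕ) (x y : ℤ_[p])
    (h : ‖x - y‖ ≤ (p : ℝ) ^ (-((k + 1 : ℕ) : ℤ))) :
    ‖moritaGamma p x - moritaGamma p y‖ ≤ (p : ℝ) ^ (-((k + 1 : ℕ) : ℤ)) := by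
  have h1 := ((tendsto_gammaNat p hp x).comp tendsto_fst).sub
    ((tendsto_gammaNat p hp y).comp tendsto_snd)
  refine le_of_tendsto h1.norm ?_
  have e1 := (eventually_comap p x (k + 1)).prod_mk (eventually_comap p y (k + 1))
  filter_upwards [e1] with q hq
  apply gammaNat_dist p hp
  have : (q.1 : ℤ_[p]) - q.2 = ((q.1 - x) + (x - y)) - (q.2 - y) := by ring
  rw [this]
  exact (norm_sub_le_max p _ _).trans (max_le
    ((PadicInt.nonarchimedean _ _).trans (max_le hq.1 h)) hq.2)

theorem continuous_moritaGamma (hp : p ≠ 2) : Continuous (moritaGamma p) := by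
  rw [Metric.continuous_iff]
  intro y ε hε
  have hpp : p.Prime := Fact.out
  obtain ⟨k, hk⟩ := PadicInt.exists_pow_neg_lt p hε
  refine ⟨(p : ℝ) ^ (-((k + 1 : ℕ) : ℤ)), zpow_pos (by exact_mod_cast hpp.pos) _, fun x hx => ?_⟩
  have hle : (p : ℝ) ^ (-((k + 1 : ℕ) : ℤ)) ≤ (p : ℝ) ^ (-(k : ℤ)) := by
    apply zpow_le_zpow_right₀ (by exact_mod_cast hpp.one_le)
    push_cast; omega
  rw [dist_eq_norm] at hx ⊢
  exact lt_of_le_of_lt ((moritaGamma_dist p hp k x y hx.le).trans hle) hk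

theorem moritaGamma_natCast (hp : p ≠ 2) (n : ℕ) : moritaGamma p n = gammaNat p n := by
  refine tendsto_nhds_unique (l := pure n) ?_ (tendsto_pure_nhds (gammaNat p) n)
  refine (tendsto_gammaNat p hp n).mono_left ?_
  rw [← map_le_iff_le_comap, map_pure]
  exact pure_le_nhds _

theorem isMorita_moritaGamma (hp : p ≠ 2) : IsMorita p (moritaGamma p) := by
  have hc := continuous_moritaGamma p hp
  have hopen : ∀ x : ℤ_[p], ∀ᶠ n : ℕ in comap (Nat.cast : ℕ → ℤ_[p]) (𝓝 x),
      (p ∣ n ↔ ‖x‖ < 1) := by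
    intro x
    filter_upwards [eventually_comap p x 1] with n hn
    have hlt : ‖(n : ℤ_[p]) - x‖ < 1 := by
      refine lt_of_le_of_lt hn ?_
      simpa using inv_lt_one_of_one_lt₀
        (by exact_mod_cast (Fact.out : p.Prime).one_lt : (1 : ℝ) < p)
    rw [← PadicInt.norm_natCast_lt_one_iff]
    constructor
    · intro h
      have : x = n - (n - x) := by ring
      rw [this]
      exact (norm_sub_le_max p _ _).trans_lt (max_lt h hlt)
    · intro h
      have : (n : ℤ_[p]) = (n - x) + x := by ring
      rw [this]
      exact (PadicInt.nonarchimedean _ _).trans_lt (max_lt hlt h)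
  have hcast : ∀ x : ℤ_[p], Tendsto (Nat.cast : ℕ → ℤ_[p]) (comap Nat.cast (𝓝 x)) (𝓝 x) :=
    fun x => tendsto_comap
  have hsucc : ∀ x : ℤ_[p], Tendsto (fun n : ℕ => gammaNat p (n + 1))
      (comap Nat.cast (𝓝 x)) (𝓝 (moritaGamma p (x + 1))) := by
    intro x
    have h1 : Tendsto (fun n : ℕ => moritaGamma p ((n : ℤ_[p]) + 1))
        (comap Nat.cast (𝓝 x)) (𝓝 (moritaGamma p (x + 1))) :=
      (hc.tendsto _).comp ((hcast x).add_const 1)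
    refine h1.congr fun n => ?_
    rw [← moritaGamma_natCast p hp]
    push_cast
    rfl
  refine ⟨hc, ?_, ?_, ?_⟩
  · have := moritaGamma_natCast p hp 0
    rw [gammaNat_zero] at this
    simpa using this
  · intro x hx
    refine tendsto_nhds_unique (hsucc x)
      (((hcast x).neg.mul (tendsto_gammaNat p hp x)).congr' ?_)
    filter_upwards [hopen x] with n hn
    rw [gammaNat_succ, if_neg (by rw [hn, hx]; exact lt_irrefl _)]
  · intro x hx
    refine tendsto_nhds_unique (hsucc x) ((tendsto_gammaNat p hp x).neg.congr' ?_)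
    filter_upwards [hopen x] with n hn
    rw [gammaNat_succ, if_pos (hn.2 hx), neg_one_mul]

variable {p}

theorem IsMorita.eq {Γ Γ' : ℤ_[p] → ℤ_[p]} (h : IsMorita p Γ) (h' : IsMorita p Γ') : Γ = Γ' := by
  refine PadicInt.denseRange_natCast.equalizer h.continuous h'.continuous (funext fun n => ?_)
  induction n with
  | zero => simp [h.map_zero, h'.map_zero]
  | succ n ih =>
    simp only [Function.comp_apply, Nat.cast_succ] at ih ⊢
    rcases (PadicInt.norm_le_one (n : ℤ_[p])).lt_or_eq with hn | hn
    · rw [h.map_add_one_of_nonunit _ hn, h'.map_add_one_of_nonunit _ hn, ih]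
    · rw [h.map_add_one_of_unit _ hn, h'.map_add_one_of_unit _ hn, ih]

end Gamma

/-- `Y` is the Taylor expansion at `0` of the function `f` on `ℤ_p`: it converges to `f` on a
neighbourhood of `0`. -/
def IsTaylorExpansionAtZero {p : ℕ} [Fact p.Prime] (f : ℤ_[p] → ℤ_[p]) (Y : ℚ_[p]⟦X⟧) : Prop :=
  ∃ ε : ℝ, 0 < ε ∧ ∀ x : ℤ_[p], ‖x‖ < ε →
    HasSum (fun n => coeff n Y * (x : ℚ_[p]) ^ n) (f x : ℚ_[p])

/-! ## Analytic functions and rank one differential equations on discs -/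

/-- The power series `∑ a_i (T - t)^i` is an analytic function on the open disc `D⁻(t, r)`:
`|a_i| s^i → 0` for all `s` in `[0, r)`. -/
def IsAnalyticOnDisc {L : Type*} [NormedField L] (f : L⟦X⟧) (r : ℝ) : Prop :=
  ∀ s : ℝ, 0 ≤ s → s < r → Tendsto (fun i => ‖coeff i f‖ * s ^ i) atTop (𝓝 0)

/-- The value `|f|(x_{0,ρ}) = sup_i |a_i| ρ^i` at the point `x_{0,ρ}` of `f = ∑ a_i T^i`. It is
used for polynomials and for `f` analytic on a disc of radius `> ρ`, where the supremum is
finite. -/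
def gaussPoint {K : Type*} [NormedField K] (ρ : ℝ) (f : K⟦X⟧) : ℝ :=
  PowerSeries.gaussNorm (fun a : K => ‖a‖) ρ f

/-- The `Ω`-rational point `t` lies over the point `x_{0,ρ}` of the affine line over `K`:
`|f(t)| = |f|(x_{0,ρ})` for all polynomials `f` over `K`. -/
def LiesOver {K Ω : Type*} [NormedField K] [NormedField Ω] [NormedAlgebra K Ω]
    (t : Ω) (ρ : ℝ) : Prop :=
  ∀ f : Polynomial K, ‖Polynomial.aeval t f‖ = gaussPoint ρ (f : K⟦X⟧)

/-- The expansion at `t` of `g = ∑ a_n T^n`, as a power series in `T - t`: its `k`-th coefficient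
is `∑_n binom(n + k, k) a_{n+k} t^n`. -/
def expandAt {K Ω : Type*} [NormedField K] [NormedField Ω] [NormedAlgebra K Ω]
    (g : K⟦X⟧) (t : Ω) : Ω⟦X⟧ :=
  PowerSeries.mk fun k =>
    ∑' n : ℕ, ((n + k).choose k : Ω) * algebraMap K Ω (coeff (n + k) g) * t ^ n

/-- The rank one differential module associated to `Y' = g Y` is trivial on the disc `D⁻(t, r)`
over `Ω`, i.e. isomorphic there to `(𝒪, d/dT)`. An isomorphism between free modules of rank one is
given by an invertible analytic function `Y`, and it is compatible with the connections if and
only if `Y' = g Y`. -/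
def IsTrivialOnDisc {K Ω : Type*} [NormedField K] [NormedField Ω] [NormedAlgebra K Ω]
    (g : K⟦X⟧) (t : Ω) (r : ℝ) : Prop :=
  ∃ Y Z : Ω⟦X⟧, IsAnalyticOnDisc Y r ∧ IsAnalyticOnDisc Z r ∧ Y * Z = 1 ∧
    PowerSeries.derivative Ω Y = expandAt g t * Y

/-- For `g` analytic on the open unit disc `X = D⁻(0, 1)` with the empty weak triangulation, so
that the maximal disc of each point `x` of `X` is `D⁻(0, 1)` over `Ω`, and for an `Ω`-rational
point `t` over `x`: the number `R` is the radius at `x` of the differential module `ℱ` associated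
to `Y' = g Y`, i.e. the radius of the largest open disc centered at `t`, contained in the unit
disc, on which `ℱ` is trivial. -/
def IsRadiusAt {K Ω : Type*} [NormedField K] [NormedField Ω] [NormedAlgebra K Ω]
    (g : K⟦X⟧) (t : Ω) (R : ℝ) : Prop :=
  IsGreatest {r : ℝ | 0 < r ∧ r ≤ 1 ∧ IsTrivialOnDisc g t r} R

/-! ## The constants -/

/-- `|p| = p⁻¹` in `ℚ_p`. -/
def absP (p : ℕ) [Fact p.Prime] : ℝ := ‖(p : ℚ_[p])‖

/-- `ω = lim |n!|^{1/n} = |p|^{1/(p-1)}`. -/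
def omega (p : ℕ) [Fact p.Prime] : ℝ := absP p ^ (1 / ((p : ℝ) - 1))

/-- `r_0 = |p|^{1/p}` and `r_n = ω^{1/(p^{n-1}(p-1))}` for `n ≥ 1`. -/
def breakRadius (p : ℕ) [Fact p.Prime] : ℕ → ℝ
  | 0 => absP p ^ (1 / (p : ℝ))
  | n + 1 => omega p ^ (1 / ((p : ℝ) ^ n * ((p : ℝ) - 1)))

end MoritaGamma

end

open MoritaGamma

noncomputable section

namespace MoritaGamma

/-! ## Formal solutions of rank one equations -/

section FormalSolution

/-! On pℤ_p the functional equation gives Γ_p(T + p) = U(T) Γ_p(T) with U = -(T + 1)⋯(T + p - 1)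
(`shiftPoly`). For the logarithmic derivative this is the difference equation g(T + p) - g(T) =
f'(T), f = ∑_j log(1 + T/j). Applying D/(e^{pD} - 1) to f solves it: g = ∑_m B_m p^{m-1} f^{(m)}/m!
(`logDerivSeries`, `expandAt_logDerivSeries`). A constant δ in ℤ_p is then added to g so that the
solution Y of Y' = gY has Y(p) = U(0) (`exists_evalAt_odeSol_C_eq`). It follows that Y(T + p) = U Y,
so Y equals Γ_p on pℕ by induction and on pℤ_p by continuity.

Everything else depends only on the sizes of the coefficients a_i of g₀ (`HasGammaCoeffs`). In i·a_i
the terms with m ≥ 1 are integral, and the term m = 0 is ±S_i/p, where S_i = ∑_j j^{-i} is a unit if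
p - 1 divides i and is divisible by p otherwise. Thus the dominant terms are those of index p^v(p -
1), with |a_i| = p^{v+1}, and r_{v+1} is the radius at which the terms v and v + 1 have the same
size (`dominant_le_dominant`).

For the radii, z_k = k! y_k is an integral polynomial in the a_i, isobaric of weight k if a_i has
weight i + 1. So |a_i| ≤ G^{i+1} implies |z_k| ≤ G^k, and Y converges up to ω/G. If ρ > r_0, the
constant term of the expansion of g₀ at t has size G = |g₀|(x_{0,ρ}) > 1/ρ and dominates strictly;
then |z_k| = G^k, and the indices k = p^j show that ω/G is optimal. If ρ ≤ r_0, taking G = 1/r_0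
gives the lower bound ω r_0. For the upper bound, z_k at 0 is no larger than z_k at t
(`LiesOver.norm_odeSeq_le`), which reduces to the origin. There, with b = a_{p-1}, the product of Y
and the solution attached to bT^{p-1} - g₀ is exp(bT^p/p), which has radius exactly ω r_0, while the
second factor converges on a strictly larger disc. -/

/-- The sequence `z_k = k! y_k`, where `∑ y_k T^k` is the solution with constant term `1` of
`Y' = (∑ a_i T^i) Y`. -/
def odeSeq {R : Type*} [CommRing R] (a : ℕ → R) : ℕ → R
  | 0 => 1
  | k + 1 => ∑ i : Fin (k + 1), (k.descFactorial i : R) * a i * odeSeq a (k - i)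

theorem odeSeq_succ {R : Type*} [CommRing R] (a : ℕ → R) (k : ℕ) :
    odeSeq a (k + 1) =
      ∑ i ∈ Finset.range (k + 1), (k.descFactorial i : R) * a i * odeSeq a (k - i) := by
  rw [odeSeq, Finset.sum_range]

/-- z_k is a universal polynomial with integer coefficients in the `a i`, so it commutes with
evaluation of polynomials at `t` and at `0`. -/
theorem map_odeSeq {R S : Type*} [CommRing R] [CommRing S] (φ : R →+* S) (a : ℕ → R) (k : ℕ) :
    φ (odeSeq a k) = odeSeq (fun i => φ (a i)) k := by
  induction k using Nat.strong_induction_on with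
  | _ k ih =>
    cases k with
    | zero => simp [odeSeq]
    | succ k =>
      rw [odeSeq_succ, odeSeq_succ, map_sum]
      refine Finset.sum_congr rfl fun i _ => ?_
      rw [map_mul, map_mul, map_natCast, ih _ (by omega)]

theorem tendsto_odeSeq {R ι : Type*} [CommRing R] [TopologicalSpace R] [IsTopologicalRing R]
    {l : Filter ι} {a : ι → ℕ → R} {b : ℕ → R} (h : ∀ i, Tendsto (fun N => a N i) l (𝓝 (b i)))
    (k : ℕ) : Tendsto (fun N => odeSeq (a N) k) l (𝓝 (odeSeq b k)) := by
  induction k using Nat.strong_induction_on with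
  | _ k ih =>
    cases k with
    | zero => simpa [odeSeq] using tendsto_const_nhds
    | succ k =>
      simp only [odeSeq_succ]
      exact tendsto_finsetSum _ fun i _ => ((h i).const_mul _).mul (ih _ (by omega))

theorem odeSeq_congr {R : Type*} [CommRing R] {a b : ℕ → R} {k : ℕ} (h : ∀ i < k, a i = b i) :
    odeSeq a k = odeSeq b k := by
  induction k using Nat.strong_induction_on with
  | _ k ih =>
    cases k with
    | zero => simp [odeSeq]
    | succ k =>
      rw [odeSeq_succ, odeSeq_succ]
      refine Finset.sum_congr rfl fun i hi => ?_
      rw [Finset.mem_range] at hi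
      rw [h i hi, ih _ (by omega) fun j hj => h j (by omega)]

/-! ### Ultrametric estimates for the numbers z_k. -/

section Norm

variable {L : Type*} [NormedField L] [IsUltrametricDist L] {a : ℕ → L} {G : ℝ}

theorem norm_natCast_mul_le (n : ℕ) (x : L) : ‖(n : L) * x‖ ≤ ‖x‖ := by
  rw [norm_mul]
  exact mul_le_of_le_one_left (norm_nonneg _) (IsUltrametricDist.norm_natCast_le_one L n)

/-- The recursion is isobaric when `a i` has weight `i + 1`, and its integer coefficients have norm
at most 1. Using z_k = k! y_k keeps denominators out. -/
theorem norm_odeSeq_le (hG : 0 ≤ G) (h : ∀ i, ‖a i‖ ≤ G ^ (i + 1)) (k : ℕ) :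
    ‖odeSeq a k‖ ≤ G ^ k := by
  induction k using Nat.strong_induction_on with
  | _ k ih =>
    cases k with
    | zero => simp [odeSeq]
    | succ k =>
      rw [odeSeq_succ]
      refine IsUltrametricDist.norm_sum_le_of_forall_le_of_nonneg (by positivity) fun i hi => ?_
      rw [Finset.mem_range] at hi
      rw [mul_assoc]
      refine (norm_natCast_mul_le _ _).trans ?_
      rw [norm_mul]
      calc _ ≤ G ^ (i + 1) * G ^ (k - i) :=
            mul_le_mul (h i) (ih _ (by omega)) (norm_nonneg _) (by positivity)
        _ = G ^ (k + 1) := by rw [← pow_add]; congr 1; omega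

/-- The term `i = 0` of the recursion is a_0 z_k, of norm exactly G^{k+1} by induction; the others
are strictly smaller, so nothing cancels it. -/
theorem norm_odeSeq_eq (hG : 0 < G) (h0 : ‖a 0‖ = G) (h : ∀ i, 1 ≤ i → ‖a i‖ < G ^ (i + 1))
    (k : ℕ) : ‖odeSeq a k‖ = G ^ k := by
  have hle : ∀ i, ‖a i‖ ≤ G ^ (i + 1) := by
    intro i
    rcases Nat.eq_zero_or_pos i with rfl | hi
    · simp [h0]
    · exact (h i hi).le
  induction k with
  | zero => simp [odeSeq]
  | succ k ih =>
    rw [odeSeq_succ, Finset.sum_range_succ', add_comm]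
    have hmain : ‖((k.descFactorial 0 : ℕ) : L) * a 0 * odeSeq a (k - 0)‖ = G ^ (k + 1) := by
      simp [h0, ih, pow_succ']
    rw [← hmain]
    have hlt : ‖∑ i ∈ Finset.range k, ((k.descFactorial (i + 1) : ℕ) : L) * a (i + 1) *
        odeSeq a (k - (i + 1))‖ < G ^ (k + 1) := by
      rcases Nat.eq_zero_or_pos k with rfl | hk
      · simpa using hG
      -- The sum is bounded by one of its terms, which preserves strictness.
      obtain ⟨i, hi, hmax⟩ := IsUltrametricDist.exists_norm_finsetSum_le_of_nonempty
        (t := Finset.range k) ⟨0, by simpa using hk⟩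
        (fun i => ((k.descFactorial (i + 1) : ℕ) : L) * a (i + 1) * odeSeq a (k - (i + 1)))
      refine hmax.trans_lt ?_
      rw [Finset.mem_range] at hi
      rw [mul_assoc]
      refine (norm_natCast_mul_le _ _).trans_lt ?_
      rw [norm_mul]
      calc _ ≤ ‖a (i + 1)‖ * G ^ (k - (i + 1)) :=
            mul_le_mul_of_nonneg_left (norm_odeSeq_le hG.le hle _) (norm_nonneg _)
        _ < G ^ (i + 1 + 1) * G ^ (k - (i + 1)) :=
            mul_lt_mul_of_pos_right (h _ (by omega)) (by positivity)
        _ = G ^ (k + 1) := by rw [← pow_add]; congr 1; omega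
    rw [← hmain] at hlt
    rw [IsUltrametricDist.norm_add_eq_max_of_norm_ne_norm hlt.ne', max_eq_left hlt.le]

end Norm

variable {L : Type*} [Field L]

/-- The solution with constant term `1` of `Y' = g Y`. -/
def odeSol (g : L⟦X⟧) : L⟦X⟧ :=
  PowerSeries.mk fun k => odeSeq (fun i => coeff i g) k / (k.factorial : L)

@[simp] theorem coeff_odeSol (g : L⟦X⟧) (k : ℕ) :
    coeff k (odeSol g) = odeSeq (fun i => coeff i g) k / (k.factorial : L) := coeff_mk _ _

@[simp] theorem constantCoeff_odeSol (g : L⟦X⟧) : constantCoeff (odeSol g) = 1 := by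
  rw [← coeff_zero_eq_constantCoeff_apply, coeff_odeSol]
  simp [odeSeq]

variable [CharZero L]

theorem derivative_odeSol (g : L⟦X⟧) : derivative L (odeSol g) = g * odeSol g := by
  ext k
  have hk : ∀ n : ℕ, (n.factorial : L) ≠ 0 := fun n => Nat.cast_ne_zero.2 n.factorial_ne_zero
  rw [PowerSeries.coeff_derivative, coeff_mul, Finset.Nat.sum_antidiagonal_eq_sum_range_succ_mk,
    coeff_odeSol, odeSeq_succ, Finset.sum_div, Finset.sum_mul]
  refine Finset.sum_congr rfl fun i hi => ?_
  rw [Finset.mem_range] at hi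
  rw [coeff_odeSol]
  have h1 : ((k.descFactorial i : ℕ) : L) * ((k - i).factorial : L) = (k.factorial : L) := by
    rw [← Nat.factorial_mul_descFactorial (show i ≤ k by omega)]
    push_cast; ring
  have h2 : ((k + 1).factorial : L) = (k + 1) * k.factorial := by
    rw [Nat.factorial_succ]; push_cast; rfl
  have h3 : (k + 1 : L) ≠ 0 := by exact_mod_cast Nat.succ_ne_zero k
  rw [h2, ← h1]
  have := hk (k - i)
  have h4 : ((k.descFactorial i : ℕ) : L) ≠ 0 := by
    intro h
    exact hk k (by rw [← h1, h, zero_mul])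
  field_simp

theorem eq_C_of_derivative_eq_zero {A : L⟦X⟧} (h : derivative L A = 0) :
    A = C (constantCoeff A) := by
  apply PowerSeries.derivative.ext
  · rw [h, PowerSeries.derivative_C]
  · simp

/-- Logarithmic derivatives add, and in characteristic zero a series with zero derivative is
constant. -/
theorem odeSol_mul_odeSol (g h : L⟦X⟧) : odeSol g * odeSol h = odeSol (g + h) := by
  have key : ∀ g : L⟦X⟧, odeSol g * odeSol (-g) = 1 := by
    intro g
    rw [eq_C_of_derivative_eq_zero (A := odeSol g * odeSol (-g))]
    · simp
    · rw [Derivation.leibniz, derivative_odeSol, derivative_odeSol]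
      simp only [smul_eq_mul]; ring
  have h1 : odeSol g * odeSol h * odeSol (-(g + h)) = 1 := by
    rw [eq_C_of_derivative_eq_zero (A := odeSol g * odeSol h * odeSol (-(g + h)))]
    · simp
    · simp only [Derivation.leibniz, derivative_odeSol, smul_eq_mul]; ring
  calc odeSol g * odeSol h
      = odeSol g * odeSol h * (odeSol (g + h) * odeSol (-(g + h))) := by rw [key, mul_one]
    _ = odeSol (g + h) * (odeSol g * odeSol h * odeSol (-(g + h))) := by ring
    _ = odeSol (g + h) := by rw [h1, mul_one]

theorem odeSol_zero : odeSol (0 : L⟦X⟧) = 1 := by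
  rw [eq_C_of_derivative_eq_zero (A := odeSol 0)]
  · simp
  · rw [derivative_odeSol, zero_mul]

theorem odeSol_mul_odeSol_neg (g : L⟦X⟧) : odeSol g * odeSol (-g) = 1 := by
  rw [odeSol_mul_odeSol, add_neg_cancel, odeSol_zero]

/-- Multiplying `Y` by the inverse `odeSol (-g)` gives a series with zero derivative. -/
theorem eq_C_mul_odeSol {g Y : L⟦X⟧} (h : derivative L Y = g * Y) :
    Y = C (constantCoeff Y) * odeSol g := by
  have h1 : Y * odeSol (-g) = C (constantCoeff Y) := by
    rw [eq_C_of_derivative_eq_zero (A := Y * odeSol (-g))]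
    · simp
    · simp only [Derivation.leibniz, derivative_odeSol, smul_eq_mul, h]; ring
  rw [← h1, mul_assoc, mul_comm (odeSol (-g)), odeSol_mul_odeSol_neg, mul_one]

end FormalSolution

/-! ## Analytic functions on discs -/

section Disc

variable {L : Type*} [NormedField L]

theorem IsAnalyticOnDisc.mono {f : L⟦X⟧} {r r' : ℝ} (h : IsAnalyticOnDisc f r) (hr : r' ≤ r) :
    IsAnalyticOnDisc f r' := fun s hs hs' => h s hs (hs'.trans_le hr)

theorem isAnalyticOnDisc_of_le {f : L⟦X⟧} {r C : ℝ} (hr : 0 < r)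
    (h : ∀ i, ‖coeff i f‖ * r ^ i ≤ C) : IsAnalyticOnDisc f r := by
  intro s hs hsr
  have h1 : Tendsto (fun i => C * (s / r) ^ i) atTop (𝓝 0) := by
    simpa using (tendsto_pow_atTop_nhds_zero_of_lt_one (div_nonneg hs hr.le)
      ((div_lt_one hr).2 hsr)).const_mul C
  refine squeeze_zero (fun i => by positivity) (fun i => ?_) h1
  rw [div_pow, ← mul_div_assoc, le_div_iff₀ (by positivity)]
  calc ‖coeff i f‖ * s ^ i * r ^ i = (‖coeff i f‖ * r ^ i) * s ^ i := by ring
    _ ≤ C * s ^ i := mul_le_mul_of_nonneg_right (h i) (by positivity)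

theorem IsAnalyticOnDisc.exists_le {f : L⟦X⟧} {r s : ℝ} (h : IsAnalyticOnDisc f r) (hs : 0 ≤ s)
    (hsr : s < r) : ∃ C : ℝ, 0 ≤ C ∧ ∀ i, ‖coeff i f‖ * s ^ i ≤ C := by
  obtain ⟨C, hC⟩ := (h s hs hsr).bddAbove_range
  have hC' : ∀ i, ‖coeff i f‖ * s ^ i ≤ C := fun i => hC ⟨i, rfl⟩
  exact ⟨C, le_trans (by positivity) (hC' 0), hC'⟩

/-- A power series which converges on the disc of radius `r` decreases geometrically at smaller
radii. -/
theorem IsAnalyticOnDisc.exists_geometric {f : L⟦X⟧} {r s : ℝ} (h : IsAnalyticOnDisc f r)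
    (hs : 0 ≤ s) (hsr : s < r) :
    ∃ C q : ℝ, 0 ≤ C ∧ 0 ≤ q ∧ q < 1 ∧ ∀ i, ‖coeff i f‖ * s ^ i ≤ C * q ^ i := by
  obtain ⟨s', h1, h2⟩ := exists_between hsr
  have hs' : 0 < s' := hs.trans_lt h1
  obtain ⟨C, hC0, hC⟩ := h.exists_le hs'.le h2
  refine ⟨C, s / s', hC0, div_nonneg hs hs'.le, (div_lt_one hs').2 h1, fun i => ?_⟩
  rw [div_pow, ← mul_div_assoc, le_div_iff₀ (by positivity)]
  calc ‖coeff i f‖ * s ^ i * s' ^ i = (‖coeff i f‖ * s' ^ i) * s ^ i := by ring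
    _ ≤ C * s ^ i := mul_le_mul_of_nonneg_right (hC i) (by positivity)

theorem IsAnalyticOnDisc.mul [IsUltrametricDist L] {f g : L⟦X⟧} {r : ℝ}
    (hf : IsAnalyticOnDisc f r) (hg : IsAnalyticOnDisc g r) : IsAnalyticOnDisc (f * g) r := by
  intro s hs hsr
  obtain ⟨s', h1, h2⟩ := exists_between hsr
  have hs' : 0 < s' := hs.trans_lt h1
  obtain ⟨A, hA0, hA⟩ := hf.exists_le hs'.le h2
  obtain ⟨B, hB0, hB⟩ := hg.exists_le hs'.le h2
  refine isAnalyticOnDisc_of_le hs' (C := A * B) (fun n => ?_) s hs h1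
  have : ‖coeff n (f * g)‖ ≤ A * B / s' ^ n := by
    rw [coeff_mul]
    refine IsUltrametricDist.norm_sum_le_of_forall_le_of_nonneg (by positivity) fun i hi => ?_
    have hi := Finset.HasAntidiagonal.mem_antidiagonal.1 hi
    rw [le_div_iff₀ (by positivity), norm_mul, ← hi, pow_add]
    calc _ = (‖coeff i.1 f‖ * s' ^ i.1) * (‖coeff i.2 g‖ * s' ^ i.2) := by ring
      _ ≤ A * B := mul_le_mul (hA _) (hB _) (by positivity) hA0
  rwa [le_div_iff₀ (by positivity)] at this

theorem IsAnalyticOnDisc.add {f g : L⟦X⟧} {r : ℝ}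
    (hf : IsAnalyticOnDisc f r) (hg : IsAnalyticOnDisc g r) : IsAnalyticOnDisc (f + g) r := by
  intro s hs hsr
  have := (hf s hs hsr).add (hg s hs hsr)
  rw [add_zero] at this
  refine squeeze_zero (fun i => by positivity) (fun i => ?_) this
  rw [← add_mul, map_add]
  exact mul_le_mul_of_nonneg_right (norm_add_le _ _) (by positivity)

theorem isAnalyticOnDisc_polynomial (f : Polynomial L) (r : ℝ) :
    IsAnalyticOnDisc (f : L⟦X⟧) r := by
  intro s _ _
  refine tendsto_const_nhds.congr' ?_
  filter_upwards [eventually_gt_atTop f.natDegree] with i hi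
  rw [Polynomial.coeff_coe, Polynomial.coeff_eq_zero_of_natDegree_lt hi, norm_zero, zero_mul]

theorem IsAnalyticOnDisc.derivative [IsUltrametricDist L] {f : L⟦X⟧} {r : ℝ}
    (hf : IsAnalyticOnDisc f r) : IsAnalyticOnDisc (PowerSeries.derivative L f) r := by
  intro s hs hsr
  obtain ⟨s', h1, h2⟩ := exists_between hsr
  have hs' : 0 < s' := hs.trans_lt h1
  obtain ⟨A, hA0, hA⟩ := hf.exists_le hs'.le h2
  refine isAnalyticOnDisc_of_le hs' (C := A / s') (fun n => ?_) s hs h1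
  rw [le_div_iff₀ hs', PowerSeries.coeff_derivative, mul_comm (coeff _ _), ← Nat.cast_succ,
    mul_assoc, ← pow_succ]
  exact le_trans (mul_le_mul_of_nonneg_right (norm_natCast_mul_le _ _) (by positivity)) (hA _)

/-! ### Values of power series -/

/-- The value at `x` of a power series. -/
def evalAt (f : L⟦X⟧) (x : L) : L := ∑' n, coeff n f * x ^ n

theorem IsAnalyticOnDisc.summable_norm {f : L⟦X⟧} {r : ℝ} (h : IsAnalyticOnDisc f r) {x : L}
    (hx : ‖x‖ < r) : Summable fun n => ‖coeff n f * x ^ n‖ := by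
  obtain ⟨C, q, -, hq0, hq1, hC⟩ := h.exists_geometric (norm_nonneg x) hx
  refine Summable.of_nonneg_of_le (fun n => norm_nonneg _) (fun n => ?_)
    ((summable_geometric_of_lt_one hq0 hq1).mul_left C)
  rw [norm_mul, norm_pow]
  exact hC n

theorem evalAt_zero_right (f : L⟦X⟧) : evalAt f 0 = constantCoeff f := by
  rw [evalAt, tsum_eq_single 0 (fun n hn => by simp [hn])]
  simp

theorem evalAt_polynomial (f : Polynomial L) (x : L) : evalAt (f : L⟦X⟧) x = f.eval x := by
  rw [evalAt, Polynomial.eval_eq_sum_range, tsum_eq_sum (s := Finset.range (f.natDegree + 1))]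
  · simp
  · intro n hn
    rw [Finset.mem_range, not_lt] at hn
    rw [Polynomial.coeff_coe, Polynomial.coeff_eq_zero_of_natDegree_lt (by omega), zero_mul]

theorem tsum_antidiagonal {F : ℕ × ℕ → L} (h : Summable F) :
    ∑' nk, F nk = ∑' n, ∑ nk ∈ Finset.HasAntidiagonal.antidiagonal n, F nk := by
  have h1 : Summable (F ∘ Finset.HasAntidiagonal.sigmaAntidiagonalEquivProd) :=
    (Equiv.summable_iff _).2 h
  rw [← Finset.HasAntidiagonal.sigmaAntidiagonalEquivProd.tsum_eq F]
  conv_rhs => congr; ext; rw [← Finset.sum_finset_coe, ← tsum_fintype (L := .unconditional _)]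
  exact h1.tsum_sigma' fun n => (hasSum_fintype _).summable

theorem derivative_expandAt (f : L⟦X⟧) (t : L) :
    derivative L (expandAt f t) = expandAt (derivative L f) t := by
  ext k
  rw [PowerSeries.coeff_derivative, expandAt, expandAt, coeff_mk, coeff_mk, ← tsum_mul_right]
  refine tsum_congr fun n => ?_
  rw [PowerSeries.coeff_derivative]
  have := Nat.add_one_mul_choose_eq (n + k) k
  have h2 : ((n + k + 1 : ℕ) : L) * ((n + k).choose k : L) =
      ((n + (k + 1)).choose (k + 1) : L) * ((k + 1 : ℕ) : L) := by
    rw [← Nat.cast_mul, ← Nat.cast_mul]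
    exact congrArg _ this
  push_cast at h2
  simp only [Algebra.algebraMap_self, RingHom.id_apply, ← add_assoc] at h2 ⊢
  push_cast
  linear_combination (-(coeff (n + k + 1) f * t ^ n)) * h2

variable [CompleteSpace L]

theorem IsAnalyticOnDisc.hasSum {f : L⟦X⟧} {r : ℝ} (h : IsAnalyticOnDisc f r) {x : L}
    (hx : ‖x‖ < r) : HasSum (fun n => coeff n f * x ^ n) (evalAt f x) :=
  (h.summable_norm hx).of_norm.hasSum

theorem evalAt_mul {f g : L⟦X⟧} {r : ℝ} (hf : IsAnalyticOnDisc f r) (hg : IsAnalyticOnDisc g r)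
    {x : L} (hx : ‖x‖ < r) : evalAt (f * g) x = evalAt f x * evalAt g x := by
  rw [evalAt, evalAt, evalAt, tsum_mul_tsum_eq_tsum_sum_antidiagonal_of_summable_norm
    (hf.summable_norm hx) (hg.summable_norm hx)]
  refine tsum_congr fun n => ?_
  rw [coeff_mul, Finset.sum_mul]
  refine Finset.sum_congr rfl fun i hi => ?_
  have hi := Finset.HasAntidiagonal.mem_antidiagonal.1 hi
  rw [← hi, pow_add]; ring

/-- Both sides are sums of one double family, grouped by `k` or by total degree; a geometric bound
in both indices makes it summable. -/
theorem evalAt_expandAt [IsUltrametricDist L] {f : L⟦X⟧} {r : ℝ} (h : IsAnalyticOnDisc f r)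
    {t x : L} (ht : ‖t‖ < r) (hx : ‖x‖ < r) :
    evalAt (expandAt f t) x = evalAt f (t + x) := by
  obtain ⟨C, q, hC0, hq0, hq1, hC⟩ := h.exists_geometric
    (s := max ‖t‖ ‖x‖) (le_max_of_le_left (norm_nonneg _)) (max_lt ht hx)
  let F : ℕ × ℕ → L := fun kn =>
    ((kn.2 + kn.1).choose kn.1 : L) * coeff (kn.2 + kn.1) f * t ^ kn.2 * x ^ kn.1
  have hF : ∀ kn, ‖F kn‖ ≤ C * (q ^ kn.1 * q ^ kn.2) := by
    rintro ⟨k, n⟩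
    have h1 : ‖F (k, n)‖ ≤ ‖coeff (n + k) f‖ * (max ‖t‖ ‖x‖) ^ (n + k) := by
      simp only [F]
      rw [mul_assoc, mul_assoc]
      refine (norm_natCast_mul_le _ _).trans ?_
      rw [norm_mul, norm_mul, norm_pow, norm_pow, pow_add]
      gcongr
      · exact le_max_left _ _
      · exact le_max_right _ _
    refine h1.trans ((hC _).trans ?_)
    rw [pow_add, mul_comm (q ^ n)]
  have hsum : Summable F := by
    refine Summable.of_norm_bounded (g := fun nk : ℕ × ℕ => C * (q ^ nk.1 * q ^ nk.2)) ?_ hF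
    exact ((summable_geometric_of_lt_one hq0 hq1).mul_of_nonneg
      (summable_geometric_of_lt_one hq0 hq1) (fun n => pow_nonneg hq0 n)
      (fun n => pow_nonneg hq0 n)).mul_left C
  have e1 : ∑' kn, F kn = evalAt (expandAt f t) x := by
    rw [hsum.tsum_prod, evalAt]
    refine tsum_congr fun k => ?_
    rw [expandAt, coeff_mk, ← tsum_mul_right]
    rfl
  rw [← e1, tsum_antidiagonal hsum, evalAt]
  refine tsum_congr fun m => ?_
  rw [add_comm t x, add_pow, Finset.mul_sum, Finset.Nat.sum_antidiagonal_eq_sum_range_succ_mk]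
  refine Finset.sum_congr rfl fun k hk => ?_
  rw [Finset.mem_range] at hk
  simp only [F]
  rw [show m - k + k = m by omega]
  ring

theorem norm_coeff_expandAt_le {K Ω : Type*} [NormedField K] [NormedField Ω] [NormedAlgebra K Ω]
    [IsUltrametricDist Ω] {g : K⟦X⟧} {t : Ω} {k : ℕ} {B : ℝ}
    (h : ∀ n, ‖coeff (n + k) g‖ * ‖t‖ ^ n ≤ B) : ‖coeff k (expandAt g t)‖ ≤ B := by
  rw [expandAt, coeff_mk]
  refine IsUltrametricDist.norm_tsum_le_of_forall_le_of_nonneg (le_trans (by positivity) (h 0))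
    fun n => ?_
  rw [mul_assoc]
  refine (norm_natCast_mul_le _ _).trans ?_
  rw [norm_mul, norm_algebraMap', norm_pow]
  exact h n

theorem isAnalyticOnDisc_expandAt {K Ω : Type*} [NormedField K] [NormedField Ω]
    [NormedAlgebra K Ω] [IsUltrametricDist Ω] {f : K⟦X⟧} {r : ℝ} (h : IsAnalyticOnDisc f r)
    {t : Ω} (ht : ‖t‖ < r) : IsAnalyticOnDisc (expandAt f t) r := by
  intro s hs hsr
  obtain ⟨s', h1, h2⟩ := exists_between (max_lt hsr ht)
  have hs' : 0 < s' := hs.trans_lt ((le_max_left _ _).trans_lt h1)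
  obtain ⟨C, hC0, hC⟩ := h.exists_le hs'.le h2
  refine isAnalyticOnDisc_of_le hs' (C := C) (fun k => ?_) s hs ((le_max_left _ _).trans_lt h1)
  have : ‖coeff k (expandAt f t)‖ ≤ C / s' ^ k := by
    refine norm_coeff_expandAt_le fun n => ?_
    rw [le_div_iff₀ (by positivity)]
    refine le_trans ?_ (hC (n + k))
    rw [pow_add, ← mul_assoc]
    gcongr
    exact ((le_max_right _ _).trans_lt h1).le
  rwa [le_div_iff₀ (by positivity)] at this

/-- The principle of isolated zeros, for power series. -/
theorem eq_zero_of_evalAt_eq_zero {𝕜 : Type*} [NontriviallyNormedField 𝕜] [CompleteSpace 𝕜]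
    {f : 𝕜⟦X⟧} {r : ℝ} (hr : 0 < r) (hf : IsAnalyticOnDisc f r)
    (h : ∀ x : 𝕜, ‖x‖ < r → evalAt f x = 0) : f = 0 := by
  have h1 : HasFPowerSeriesAt (0 : 𝕜 → 𝕜)
      (FormalMultilinearSeries.ofScalars 𝕜 fun n => coeff n f) 0 := by
    rw [hasFPowerSeriesAt_iff]
    filter_upwards [Metric.ball_mem_nhds (0 : 𝕜) hr] with x hx
    rw [Metric.mem_ball, dist_zero_right] at hx
    have := hf.hasSum hx
    rw [h x hx] at this
    simpa [FormalMultilinearSeries.coeff_ofScalars, mul_comm] using this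
  have h2 := h1.eq_zero
  ext n
  have h3 := congrArg (fun q : FormalMultilinearSeries 𝕜 𝕜 𝕜 => q.coeff n) h2
  simp only [FormalMultilinearSeries.coeff_ofScalars] at h3
  rw [h3]
  simp [FormalMultilinearSeries.coeff]

/-- Both sides converge on the disc and take the value (fg)(t + x) at every x there, so isolated
zeros replace a manipulation of double series. -/
theorem expandAt_mul {𝕜 : Type*} [NontriviallyNormedField 𝕜] [CompleteSpace 𝕜]
    [IsUltrametricDist 𝕜] {f g : 𝕜⟦X⟧} {r : ℝ} (hf : IsAnalyticOnDisc f r)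
    (hg : IsAnalyticOnDisc g r) {t : 𝕜} (ht : ‖t‖ < r) :
    expandAt (f * g) t = expandAt f t * expandAt g t := by
  have hr : 0 < r := (norm_nonneg t).trans_lt ht
  have af := isAnalyticOnDisc_expandAt hf ht
  have ag := isAnalyticOnDisc_expandAt hg ht
  have afg := isAnalyticOnDisc_expandAt (hf.mul hg) ht
  have an : IsAnalyticOnDisc (-(expandAt f t * expandAt g t)) r := by
    intro s hs hsr
    simpa using (af.mul ag) s hs hsr
  rw [← sub_eq_zero, sub_eq_add_neg]
  refine eq_zero_of_evalAt_eq_zero hr (afg.add an) fun x hx => ?_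
  have htx : ‖t + x‖ < r := (IsUltrametricDist.norm_add_le_max t x).trans_lt (max_lt ht hx)
  have e1 := (afg.hasSum hx).sub ((af.mul ag).hasSum hx)
  rw [evalAt_mul af ag hx, evalAt_expandAt (hf.mul hg) ht hx, evalAt_expandAt hf ht hx,
    evalAt_expandAt hg ht hx, evalAt_mul hf hg htx, sub_self] at e1
  rw [evalAt, ← e1.tsum_eq]
  refine tsum_congr fun n => ?_
  rw [map_add, map_neg]; ring

end Disc

/-! ## The constants -/

section Constants

variable (p : ℕ) [hpf : Fact p.Prime]

theorem absP_eq : absP p = (p : ℝ)⁻¹ := Padic.norm_p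

theorem absP_pos : 0 < absP p := by
  rw [absP_eq]; exact inv_pos.2 (by exact_mod_cast hpf.out.pos)

theorem one_lt_natCast : (1 : ℝ) < p := by exact_mod_cast hpf.out.one_lt

theorem natCast_pos : (0 : ℝ) < p := by exact_mod_cast hpf.out.pos

theorem absP_lt_one : absP p < 1 := by
  rw [absP_eq]; exact inv_lt_one_of_one_lt₀ (one_lt_natCast p)

theorem rpow_one_div_pow {x : ℝ} (hx : 0 ≤ x) {m : ℕ} (hm : m ≠ 0) :
    (x ^ (1 / (m : ℝ))) ^ m = x := by
  rw [one_div, Real.rpow_inv_natCast_pow hx hm]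

theorem cast_sub_one : ((p - 1 : ℕ) : ℝ) = (p : ℝ) - 1 := by
  rw [Nat.cast_sub hpf.out.one_le, Nat.cast_one]

theorem sub_one_ne_zero : p - 1 ≠ 0 := by
  have := hpf.out.two_le; omega

theorem omega_pow : omega p ^ (p - 1) = (p : ℝ)⁻¹ := by
  rw [omega, ← cast_sub_one, rpow_one_div_pow (absP_pos p).le (sub_one_ne_zero p), absP_eq]

theorem omega_pos : 0 < omega p := Real.rpow_pos_of_pos (absP_pos p) _

theorem omega_lt_one : omega p < 1 := by
  refine Real.rpow_lt_one (absP_pos p).le (absP_lt_one p) (one_div_pos.2 ?_)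
  linarith [one_lt_natCast p]

theorem breakRadius_pos (n : ℕ) : 0 < breakRadius p n := by
  cases n
  · exact Real.rpow_pos_of_pos (absP_pos p) _
  · exact Real.rpow_pos_of_pos (omega_pos p) _

theorem breakRadius_zero_pow : breakRadius p 0 ^ p = (p : ℝ)⁻¹ := by
  rw [breakRadius, rpow_one_div_pow (absP_pos p).le hpf.out.ne_zero, absP_eq]

theorem breakRadius_succ_pow (n : ℕ) :
    breakRadius p (n + 1) ^ (p ^ n * (p - 1) ^ 2) = (p : ℝ)⁻¹ := by
  have h : p ^ n * (p - 1) ≠ 0 := mul_ne_zero (pow_ne_zero _ hpf.out.ne_zero) (sub_one_ne_zero p)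
  have h2 : breakRadius p (n + 1) = omega p ^ (1 / ((p ^ n * (p - 1) : ℕ) : ℝ)) := by
    rw [breakRadius]; push_cast; rw [cast_sub_one]
  rw [show p ^ n * (p - 1) ^ 2 = (p ^ n * (p - 1)) * (p - 1) by ring, pow_mul, h2,
    rpow_one_div_pow (omega_pos p).le h, omega_pow]

theorem norm_factorial_mul (n : ℕ) :
    ‖(((p * n).factorial : ℕ) : ℚ_[p])‖ = ‖((n.factorial : ℕ) : ℚ_[p])‖ * ((p : ℝ)⁻¹) ^ n := by
  rw [Padic.norm_eq_zpow_neg_valuation (Nat.cast_ne_zero.2 (Nat.factorial_ne_zero _)),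
    Padic.norm_eq_zpow_neg_valuation (Nat.cast_ne_zero.2 (Nat.factorial_ne_zero _)),
    Padic.valuation_natCast, Padic.valuation_natCast, padicValNat_factorial_mul, Nat.cast_add,
    neg_add, zpow_add₀ (natCast_pos p).ne', inv_pow, zpow_neg (p : ℝ) (n : ℤ), zpow_natCast]

/-- The powers of p are the indices where |k!| attains its minimal possible size ω^{k-1}. They serve
to detect divergence. -/
theorem norm_factorial_pow (j : ℕ) :
    ‖(((p ^ j).factorial : ℕ) : ℚ_[p])‖ = omega p ^ (p ^ j - 1) := by
  induction j with
  | zero => simp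
  | succ j ih =>
    rw [pow_succ', norm_factorial_mul, ih, ← omega_pow, ← pow_mul, ← pow_add]
    congr 1
    have h1 : 1 ≤ p ^ j := Nat.one_le_pow _ _ hpf.out.pos
    have h2 := hpf.out.one_le
    zify [h1, h2, (one_le_mul h2 h1 : 1 ≤ p * p ^ j)]
    ring

/-- Legendre: (p - 1) v_p(k!) is `k` minus its digit sum. -/
theorem omega_pow_le_norm_factorial (k : ℕ) :
    omega p ^ k ≤ ‖((k.factorial : ℕ) : ℚ_[p])‖ := by
  rw [Padic.norm_eq_zpow_neg_valuation (Nat.cast_ne_zero.2 (Nat.factorial_ne_zero _)),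
    Padic.valuation_natCast, zpow_neg, zpow_natCast, ← inv_pow, ← omega_pow, ← pow_mul,
    sub_one_mul_padicValNat_factorial]
  exact pow_le_pow_of_le_one (omega_pos p).le (omega_lt_one p).le (Nat.sub_le _ _)

variable {p}
variable {Ω : Type*} [NormedField Ω] [NormedAlgebra ℚ_[p] Ω]

theorem norm_natCast_eq (n : ℕ) : ‖(n : Ω)‖ = ‖(n : ℚ_[p])‖ := by
  rw [← map_natCast (algebraMap ℚ_[p] Ω) n, norm_algebraMap']

theorem isAnalyticOnDisc_odeSol [IsUltrametricDist Ω] {g : Ω⟦X⟧} {G : ℝ} (hG : 0 < G)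
    (h : ∀ i, ‖coeff i g‖ ≤ G ^ (i + 1)) : IsAnalyticOnDisc (odeSol g) (omega p / G) := by
  have hw := omega_pos p
  refine isAnalyticOnDisc_of_le (C := 1) (div_pos hw hG) fun k => ?_
  have hk := (norm_natCast_eq (p := p) (Ω := Ω) k.factorial).symm ▸ omega_pow_le_norm_factorial p k
  rw [coeff_odeSol, norm_div, div_pow, div_mul_div_comm, div_le_one (by
    have := (pow_pos hw k).trans_le hk
    positivity), mul_comm]
  exact mul_le_mul hk (norm_odeSeq_le hG.le h k) (norm_nonneg _) (norm_nonneg _)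

end Constants

/-! ## The size of the coefficients of `g₀` -/

section Coefficients

variable {p : ℕ} [hpf : Fact p.Prime]

/-- The sizes of the coefficients of the logarithmic derivative of the Gamma function. -/
structure HasGammaCoeffs (g : ℚ_[p]⟦X⟧) : Prop where
  zero : ‖coeff 0 g‖ ≤ 1
  not_dvd : ∀ i, ¬ (p - 1) ∣ i → ‖(i : ℚ_[p]) * coeff i g‖ ≤ 1
  dvd : ∀ i, i ≠ 0 → (p - 1) ∣ i → ‖(i : ℚ_[p]) * coeff i g‖ = p

theorem norm_natCast_pow_mul {v c : ℕ} (hc : ¬ p ∣ c) :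
    ‖((p ^ v * c : ℕ) : ℚ_[p])‖ = ((p : ℝ) ^ v)⁻¹ := by
  have : ‖((c : ℕ) : ℚ_[p])‖ = 1 :=
    Padic.norm_natCast_eq_one_iff.2 ((Nat.Prime.coprime_iff_not_dvd hpf.out).2 hc)
  push_cast
  rw [norm_mul, this, norm_pow, Padic.norm_p, mul_one, inv_pow]

variable {g : ℚ_[p]⟦X⟧} (hg : HasGammaCoeffs g)
include hg

/-- With i = p^v c and p ∤ c, division by `i` costs p^v. In the second case p^v and p - 1 are
coprime divisors of `i`. The clause for `v = 0` separates i = p - 1 from the next multiple of p - 1.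
-/
theorem HasGammaCoeffs.norm_le (i : ℕ) : (∃ v : ℕ, (v = 0 ∨ p ^ v ≤ i) ∧ ‖coeff i g‖ ≤ (p : ℝ) ^ v) ∨
    ∃ v : ℕ, p ^ v * (p - 1) ≤ i ∧ (v = 0 → i ≠ p - 1 → 2 * (p - 1) ≤ i) ∧
      ‖coeff i g‖ = (p : ℝ) ^ (v + 1) := by
  rcases Nat.eq_zero_or_pos i with rfl | hi
  · exact Or.inl ⟨0, Or.inl rfl, by simpa using hg.zero⟩
  obtain ⟨v, c, hc, hic⟩ := Nat.exists_eq_pow_mul_and_not_dvd hi.ne' p hpf.out.ne_one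
  have hn : ‖(i : ℚ_[p])‖ = ((p : ℝ) ^ v)⁻¹ := by rw [hic, norm_natCast_pow_mul hc]
  have hp0 := natCast_pos p
  have hppos := pow_pos hp0 v
  by_cases hd : (p - 1) ∣ i
  · right
    refine ⟨v, ?_, ?_, ?_⟩
    · refine Nat.le_of_dvd hi (Nat.Coprime.mul_dvd_of_dvd_of_dvd ?_ ⟨c, hic⟩ hd)
      refine Nat.Coprime.pow_left _ ?_
      exact (Nat.coprime_self_sub_right hpf.out.one_le).2 (by simp)
    · rintro - hne
      obtain ⟨k, rfl⟩ := hd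
      have hk0 : k ≠ 0 := by rintro rfl; simp at hi
      have hk1 : k ≠ 1 := by rintro rfl; simp at hne
      rw [mul_comm]
      exact Nat.mul_le_mul_left _ (by omega)
    · have := hg.dvd i hi.ne' hd
      rw [norm_mul, hn, inv_mul_eq_iff_eq_mul₀ hppos.ne'] at this
      rw [this, pow_succ]
  · left
    refine ⟨v, Or.inr ?_, ?_⟩
    · exact Nat.le_of_dvd hi ⟨c, hic⟩
    · have := hg.not_dvd i hd
      rwa [norm_mul, hn, inv_mul_le_iff₀ hppos, mul_one] at this

theorem HasGammaCoeffs.norm_eq (v : ℕ) : ‖coeff (p ^ v * (p - 1)) g‖ = (p : ℝ) ^ (v + 1) := by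
  have hp0 := natCast_pos p
  have hne : p ^ v * (p - 1) ≠ 0 :=
    mul_ne_zero (pow_ne_zero _ hpf.out.ne_zero) (sub_one_ne_zero p)
  have hnd : ¬ p ∣ p - 1 := fun h => by
    have := Nat.le_of_dvd (Nat.pos_of_ne_zero (sub_one_ne_zero p)) h
    have := hpf.out.two_le
    omega
  have := hg.dvd _ hne (dvd_mul_left _ _)
  rw [norm_mul, norm_natCast_pow_mul hnd, inv_mul_eq_iff_eq_mul₀ (pow_pos hp0 v).ne'] at this
  rw [this, pow_succ]

-- This reduces estimates at fractional powers of p to inequalities between integers.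
omit hg in
theorem pow_mul_pow_le_one {r : ℝ} (hr : 0 ≤ r) {A B e m : ℕ} (hA : A ≠ 0)
    (h : r ^ A ≤ ((p : ℝ)⁻¹) ^ B) (he : e * A ≤ m * B) : (p : ℝ) ^ e * r ^ m ≤ 1 := by
  have hp0 := natCast_pos p
  rw [← pow_le_one_iff_of_nonneg (by positivity) hA, mul_pow, ← pow_mul, ← pow_mul,
    mul_comm m A, pow_mul r]
  calc (p : ℝ) ^ (e * A) * (r ^ A) ^ m ≤ (p : ℝ) ^ (m * B) * (((p : ℝ)⁻¹) ^ B) ^ m := by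
        gcongr
        exact (one_lt_natCast p).le
    _ = 1 := by
        rw [← pow_mul, mul_comm B m, ← mul_pow, mul_inv_cancel₀ hp0.ne', one_pow]

-- The factor 2p + 1, rather than 2p, leaves room to go slightly beyond r_0.
omit hg hpf in
theorem mul_le_two_mul_pow_add_one (hp : 3 ≤ p) (v : ℕ) : v * (2 * p + 1) ≤ 2 * (p ^ v + 1) := by
  rcases Nat.eq_zero_or_pos v with rfl | hv
  · simp
  induction v, hv using Nat.le_induction with
  | base => simp
  | succ v hv ih =>
    have h1 : 1 ≤ p ^ v := Nat.one_le_pow _ _ (by omega)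
    have h2 : 3 * p ^ v ≤ p ^ (v + 1) := by rw [pow_succ']; exact Nat.mul_le_mul_right _ hp
    nlinarith

-- At v = 1 this amounts to p(p - 3) ≥ 0, an equality for p = 3. It fails at v = 0, the case of the
-- index p - 1.
omit hg hpf in
theorem mul_le_two_mul_pow_mul_add_one (hp : 3 ≤ p) {v : ℕ} (hv : 1 ≤ v) :
    (v + 1) * (2 * p + 1) ≤ 2 * (p ^ v * (p - 1) + 1) := by
  induction v, hv using Nat.le_induction with
  | base =>
    obtain ⟨q, rfl⟩ : ∃ q, p = q + 1 := ⟨p - 1, by omega⟩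
    simp only [Nat.add_sub_cancel]
    nlinarith
  | succ v hv ih =>
    have h1 : 1 ≤ p ^ v * (p - 1) := Nat.one_le_iff_ne_zero.2
      (mul_ne_zero (pow_ne_zero _ (by omega)) (by omega))
    have h2 : 3 * (p ^ v * (p - 1)) ≤ p ^ (v + 1) * (p - 1) := by
      rw [pow_succ', mul_assoc]; exact Nat.mul_le_mul_right _ hp
    nlinarith

/-- The index i = p - 1 requires p r^p ≤ 1, which is the hypothesis; no other index requires more.
-/
theorem HasGammaCoeffs.mul_pow_le_one (hp : 3 ≤ p) {r : ℝ} (hr : 0 ≤ r)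
    (h : r ^ p ≤ (p : ℝ)⁻¹) (i : ℕ) : ‖coeff i g‖ * r ^ (i + 1) ≤ 1 := by
  have h' : r ^ p ≤ ((p : ℝ)⁻¹) ^ 1 := by rwa [pow_one]
  have hp0 := natCast_pos p
  rcases hg.norm_le i with ⟨v, hv, hc⟩ | ⟨v, hv, -, hc⟩
  · refine le_trans (mul_le_mul_of_nonneg_right hc (by positivity))
      (pow_mul_pow_le_one hr hpf.out.ne_zero h' ?_)
    rcases hv with rfl | hv
    · simp
    · have := mul_le_two_mul_pow_add_one hp v
      nlinarith
  · rw [hc]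
    refine pow_mul_pow_le_one hr hpf.out.ne_zero h' ?_
    rcases Nat.eq_zero_or_pos v with rfl | hv0
    · simp at hv ⊢
      omega
    · have := mul_le_two_mul_pow_mul_add_one hp hv0
      nlinarith

/-- Once the index p - 1 is excluded, some r > r_0 is allowed, because r_0^{2p+1} = p^{-2} r_0 <
p^{-2}. -/
theorem HasGammaCoeffs.mul_pow_le_one_of_ne (hp : 3 ≤ p) {r : ℝ} (hr : 0 ≤ r)
    (h : r ^ (2 * p + 1) ≤ ((p : ℝ)⁻¹) ^ 2) {i : ℕ} (hi : i ≠ p - 1) :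
    ‖coeff i g‖ * r ^ (i + 1) ≤ 1 := by
  have hp0 := natCast_pos p
  rcases hg.norm_le i with ⟨v, hv, hc⟩ | ⟨v, hv, h2, hc⟩
  · refine le_trans (mul_le_mul_of_nonneg_right hc (by positivity))
      (pow_mul_pow_le_one hr (by omega) h ?_)
    rcases hv with rfl | hv
    · simp
    · have := mul_le_two_mul_pow_add_one hp v
      nlinarith
  · rw [hc]
    refine pow_mul_pow_le_one hr (by omega) h ?_
    rcases Nat.eq_zero_or_pos v with rfl | hv0
    · have := h2 rfl hi
      omega
    · have := mul_le_two_mul_pow_mul_add_one hp hv0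
      nlinarith

omit hg in
theorem le_sub_one_sq (hp : 3 ≤ p) : p ≤ (p - 1) ^ 2 := by
  obtain ⟨q, rfl⟩ : ∃ q, p = q + 1 := ⟨p - 1, by omega⟩
  simp only [Nat.add_sub_cancel]
  nlinarith

omit hg in
theorem lt_one_of_le_breakRadius {ρ : ℝ} {N : ℕ} (hupp : ρ ≤ breakRadius p N) : ρ < 1 := by
  refine hupp.trans_lt ?_
  have h1 : (p : ℝ)⁻¹ < 1 := inv_lt_one_of_one_lt₀ (one_lt_natCast p)
  by_contra! h
  cases N with
  | zero =>
    have := breakRadius_zero_pow p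
    have h2 := one_le_pow₀ h (n := p)
    linarith
  | succ N =>
    have := breakRadius_succ_pow p N
    have h2 := one_le_pow₀ h (n := p ^ N * (p - 1) ^ 2)
    linarith

omit hg in
theorem pow_le_of_le_breakRadius {ρ : ℝ} (hρ : 0 ≤ ρ) {N : ℕ} (hupp : ρ ≤ breakRadius p (N + 1)) :
    ρ ^ (p ^ N * (p - 1) ^ 2) ≤ (p : ℝ)⁻¹ := by
  rw [← breakRadius_succ_pow p N]
  exact pow_le_pow_left₀ hρ hupp _

omit hg in
theorem le_pow_of_breakRadius_le {ρ : ℝ} {N : ℕ} (hlow : breakRadius p (N + 1) ≤ ρ) :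
    (p : ℝ)⁻¹ ≤ ρ ^ (p ^ N * (p - 1) ^ 2) := by
  rw [← breakRadius_succ_pow p N]
  exact pow_le_pow_left₀ (breakRadius_pos p _).le hlow _

-- In power form this contains r_0 ≤ r_N, which for N ≥ 1 comes from p ≤ (p - 1)^2.
omit hg in
theorem le_pow_self_of_breakRadius_le (hp : 3 ≤ p) {ρ : ℝ} (h1 : ρ < 1) {N : ℕ}
    (hlow : breakRadius p N ≤ ρ) : (p : ℝ)⁻¹ ≤ ρ ^ p := by
  have hρ : 0 < ρ := (breakRadius_pos p _).trans_le hlow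
  cases N with
  | zero =>
    rw [← breakRadius_zero_pow p]
    exact pow_le_pow_left₀ (breakRadius_pos p _).le hlow _
  | succ N =>
    refine (le_pow_of_breakRadius_le hlow).trans (pow_le_pow_of_le_one hρ.le h1.le ?_)
    exact (le_sub_one_sq hp).trans (Nat.le_mul_of_pos_left _ (pow_pos (by omega) _))

-- The ratio of the terms v + 1 and v is p ρ^{p^v (p-1)^2}, which equals 1 exactly at r_{v+1}. For ρ
-- between r_N and r_{N+1} the terms therefore increase up to v = N and decrease afterwards.
omit hg in
theorem dominant_le_dominant (hp : 3 ≤ p) {ρ : ℝ} {N : ℕ}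
    (hlow : breakRadius p N ≤ ρ) (hupp : ρ ≤ breakRadius p (N + 1)) (v : ℕ) :
    (p : ℝ) ^ (v + 1) * ρ ^ (p ^ v * (p - 1)) ≤ (p : ℝ) ^ (N + 1) * ρ ^ (p ^ N * (p - 1)) := by
  have hp0 := natCast_pos p
  have hρ : 0 < ρ := (breakRadius_pos p _).trans_le hlow
  have hρ1 := lt_one_of_le_breakRadius hupp
  have hstep : ∀ v, (p : ℝ) ^ (v + 1 + 1) * ρ ^ (p ^ (v + 1) * (p - 1)) =
      ((p : ℝ) ^ (v + 1) * ρ ^ (p ^ v * (p - 1))) * (p * ρ ^ (p ^ v * (p - 1) ^ 2)) := by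
    intro v
    have : p ^ (v + 1) * (p - 1) = p ^ v * (p - 1) + p ^ v * (p - 1) ^ 2 := by
      obtain ⟨q, hq⟩ : ∃ q, p = q + 1 := ⟨p - 1, by omega⟩
      rw [pow_succ, show p - 1 = q by omega]
      rw [mul_assoc]
      nth_rewrite 2 [hq]
      ring
    rw [this, pow_add ρ]; ring
  rcases le_total N v with h | h
  · induction v, h using Nat.le_induction with
    | base => exact le_rfl
    | succ v hv ih =>
      refine le_trans ?_ ih
      rw [hstep]
      refine mul_le_of_le_one_right (by positivity) ?_
      rw [← le_div_iff₀' hp0, one_div]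
      refine le_trans (pow_le_pow_of_le_one hρ.le hρ1.le ?_) (pow_le_of_le_breakRadius hρ.le hupp)
      exact Nat.mul_le_mul_right _ (Nat.pow_le_pow_right (by omega) hv)
  · induction h using Nat.decreasingInduction with
    | self => exact le_rfl
    | of_succ v hv ih =>
      refine le_trans ?_ ih
      rw [hstep]
      refine le_mul_of_one_le_right (by positivity) ?_
      rw [← div_le_iff₀' hp0, one_div]
      obtain ⟨M, rfl⟩ : ∃ M, N = M + 1 := ⟨N - 1, by omega⟩
      refine (le_pow_of_breakRadius_le hlow).trans (pow_le_pow_of_le_one hρ.le hρ1.le ?_)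
      exact Nat.mul_le_mul_right _ (Nat.pow_le_pow_right (by omega) (by omega))

omit hg in
theorem mul_pow_succ_le_dominant (hp : 3 ≤ p) {ρ : ℝ} {N : ℕ}
    (hlow : breakRadius p N ≤ ρ) (hupp : ρ ≤ breakRadius p (N + 1)) :
    p * ρ ^ (p - 1) ≤ (p : ℝ) ^ (N + 1) * ρ ^ (p ^ N * (p - 1)) := by
  simpa using dominant_le_dominant hp hlow hupp 0

-- Comparison with the term v = 0 suffices: p ρ^{p-1}·ρ = p ρ^p ≥ 1 as ρ ≥ r_0.
omit hg in
theorem one_le_dominant_mul (hp : 3 ≤ p) {ρ : ℝ} {N : ℕ}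
    (hlow : breakRadius p N ≤ ρ) (hupp : ρ ≤ breakRadius p (N + 1)) :
    1 ≤ (p : ℝ) ^ (N + 1) * ρ ^ (p ^ N * (p - 1)) * ρ := by
  have hρ : 0 < ρ := (breakRadius_pos p _).trans_le hlow
  refine le_trans ?_ (mul_le_mul_of_nonneg_right (mul_pow_succ_le_dominant hp hlow hupp) hρ.le)
  have := le_pow_self_of_breakRadius_le hp (lt_one_of_le_breakRadius hupp) hlow
  rw [mul_assoc, ← pow_succ, show p - 1 + 1 = p by omega]
  rwa [← div_le_iff₀' (natCast_pos p), one_div]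

omit hg in
theorem one_lt_dominant_mul (hp : 3 ≤ p) {ρ : ℝ} {N : ℕ} (h0 : breakRadius p 0 < ρ)
    (hlow : breakRadius p N ≤ ρ) (hupp : ρ ≤ breakRadius p (N + 1)) :
    1 < (p : ℝ) ^ (N + 1) * ρ ^ (p ^ N * (p - 1)) * ρ := by
  have hρ : 0 < ρ := (breakRadius_pos p _).trans_le hlow
  refine lt_of_lt_of_le ?_
    (mul_le_mul_of_nonneg_right (mul_pow_succ_le_dominant hp hlow hupp) hρ.le)
  have := pow_lt_pow_left₀ h0 (breakRadius_pos p _).le hpf.out.ne_zero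
  rw [breakRadius_zero_pow] at this
  rw [mul_assoc, ← pow_succ, show p - 1 + 1 = p by omega]
  rwa [← div_lt_iff₀' (natCast_pos p), one_div]

/-- The size of the dominating terms of `g₀`. -/
theorem HasGammaCoeffs.mul_pow_le (hp : 3 ≤ p) {ρ : ℝ} {N : ℕ}
    (hlow : breakRadius p N ≤ ρ) (hupp : ρ ≤ breakRadius p (N + 1)) (i : ℕ) :
    ‖coeff i g‖ * ρ ^ i ≤ (p : ℝ) ^ (N + 1) * ρ ^ (p ^ N * (p - 1)) := by
  have hp0 := natCast_pos p
  have hρ : 0 < ρ := (breakRadius_pos p _).trans_le hlow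
  have hρ1 := lt_one_of_le_breakRadius hupp
  rcases hg.norm_le i with ⟨v, hv, hc⟩ | ⟨v, hv, -, hc⟩
  · refine le_trans (mul_le_mul_of_nonneg_right hc (by positivity)) ?_
    rcases Nat.eq_zero_or_pos v with rfl | hv0
    · rw [pow_zero, one_mul]
      refine (pow_le_one₀ hρ.le hρ1.le).trans ((one_le_dominant_mul hp hlow hupp).trans ?_)
      exact mul_le_of_le_one_right (by positivity) hρ1.le
    · obtain ⟨w, rfl⟩ : ∃ w, v = w + 1 := ⟨v - 1, by omega⟩
      refine le_trans ?_ (dominant_le_dominant hp hlow hupp w)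
      refine mul_le_mul_of_nonneg_left (pow_le_pow_of_le_one hρ.le hρ1.le ?_) (by positivity)
      refine le_trans ?_ (hv.resolve_left (Nat.succ_ne_zero w))
      rw [pow_succ]
      exact Nat.mul_le_mul_left _ (Nat.sub_le _ _)
  · rw [hc]
    refine le_trans ?_ (dominant_le_dominant hp hlow hupp v)
    exact mul_le_mul_of_nonneg_left (pow_le_pow_of_le_one hρ.le hρ1.le hv) (by positivity)

/-- The coefficients grow at most linearly. -/
theorem HasGammaCoeffs.isAnalyticOnDisc : IsAnalyticOnDisc g 1 := by
  intro s hs hs1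
  have hp1 := one_lt_natCast p
  have hp0 := natCast_pos p
  have hle : ∀ i, ‖coeff i g‖ ≤ p * (i + 1) := by
    intro i
    rcases hg.norm_le i with ⟨v, hv, hc⟩ | ⟨v, hv, -, hc⟩
    · have h1 : p ^ v ≤ i + 1 := by
        rcases hv with rfl | hv
        · simp
        · omega
      have h2 : (p : ℝ) ^ v ≤ i + 1 := by exact_mod_cast h1
      nlinarith
    · have h1 : p ^ v ≤ i + 1 := by
        have := Nat.le_mul_of_pos_right (p ^ v) (Nat.pos_of_ne_zero (sub_one_ne_zero p))
        omega
      have h2 : (p : ℝ) ^ v ≤ i + 1 := by exact_mod_cast h1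
      rw [hc, pow_succ']
      exact mul_le_mul_of_nonneg_left h2 hp0.le
  have h1 := ((tendsto_self_mul_const_pow_of_lt_one hs hs1).add
    (tendsto_pow_atTop_nhds_zero_of_lt_one hs hs1)).const_mul (p : ℝ)
  rw [add_zero, mul_zero] at h1
  refine squeeze_zero (fun i => by positivity) (fun i => ?_) h1
  calc ‖coeff i g‖ * s ^ i ≤ p * (i + 1) * s ^ i :=
        mul_le_mul_of_nonneg_right (hle i) (by positivity)
    _ = _ := by ring

omit hg in
theorem gaussPoint_eq {K : Type*} [NormedField K] {f : K⟦X⟧} {ρ M : ℝ}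
    (h : ∀ i, ‖coeff i f‖ * ρ ^ i ≤ M) {i : ℕ} (hi : ‖coeff i f‖ * ρ ^ i = M) :
    gaussPoint ρ f = M := by
  rw [gaussPoint, gaussNorm_eq]
  refine le_antisymm (ciSup_le h) ?_
  rw [← hi]
  exact le_ciSup (f := fun i => ‖coeff i f‖ * ρ ^ i) ⟨M, by rintro _ ⟨i, rfl⟩; exact h i⟩ i

omit hg in
theorem le_gaussPoint_polynomial {K : Type*} [NormedField K] (f : Polynomial K) (ρ : ℝ) (i : ℕ) :
    ‖f.coeff i‖ * ρ ^ i ≤ gaussPoint ρ (f : K⟦X⟧) := by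
  rw [gaussPoint, gaussNorm_eq]
  have : BddAbove (Set.range fun i => ‖coeff i (f : K⟦X⟧)‖ * ρ ^ i) := by
    refine Tendsto.bddAbove_range (a := 0) (tendsto_const_nhds.congr' ?_)
    filter_upwards [eventually_gt_atTop f.natDegree] with i hi
    rw [Polynomial.coeff_coe, Polynomial.coeff_eq_zero_of_natDegree_lt hi, norm_zero, zero_mul]
  rw [← Polynomial.coeff_coe]
  exact le_ciSup this i

theorem HasGammaCoeffs.gaussPoint_eq (hp : 3 ≤ p) {ρ : ℝ} {N : ℕ}
    (hlow : breakRadius p N ≤ ρ) (hupp : ρ ≤ breakRadius p (N + 1)) :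
    gaussPoint ρ g = (p : ℝ) ^ (N + 1) * ρ ^ (p ^ N * (p - 1)) :=
  MoritaGamma.gaussPoint_eq (hg.mul_pow_le hp hlow hupp) (by rw [hg.norm_eq])

theorem HasGammaCoeffs.gaussPoint_le (hp : 3 ≤ p) {ρ : ℝ} (hρ : 0 < ρ)
    (hupp : ρ ≤ breakRadius p 0) : gaussPoint ρ g ≤ ρ⁻¹ := by
  rw [gaussPoint, gaussNorm_eq]
  refine ciSup_le fun i => ?_
  rw [← one_div, le_div_iff₀ hρ, mul_assoc, ← pow_succ]
  refine hg.mul_pow_le_one hp hρ.le ?_ i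
  rw [← breakRadius_zero_pow p]
  exact pow_le_pow_left₀ hρ.le hupp _

end Coefficients

/-! ## Points over `x_{0,ρ}` -/

section LiesOver

variable {K Ω : Type*} [NormedField K] [NormedField Ω] [NormedAlgebra K Ω] {t : Ω} {ρ : ℝ}

theorem LiesOver.norm_eq (h : LiesOver (K := K) t ρ) (hρ : 0 ≤ ρ) : ‖t‖ = ρ := by
  have := h Polynomial.X
  rw [Polynomial.aeval_X] at this
  rw [this]
  refine gaussPoint_eq (i := 1) (fun i => ?_) ?_
  · rw [Polynomial.coeff_coe, Polynomial.coeff_X]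
    split_ifs with hi
    · simp [← hi]
    · simpa using hρ
  · simp

theorem LiesOver.norm_coeff_zero_le (h : LiesOver (K := K) t ρ) (f : Polynomial K) :
    ‖f.coeff 0‖ ≤ ‖Polynomial.aeval t f‖ := by
  rw [h f]
  simpa using le_gaussPoint_polynomial f ρ 0

variable [CompleteSpace Ω]

theorem hasSum_coeff_expandAt [IsUltrametricDist Ω] {g : K⟦X⟧} {r : ℝ} (hg : IsAnalyticOnDisc g r)
    (ht : ‖t‖ < r) (k : ℕ) :
    HasSum (fun n : ℕ => ((n + k).choose k : Ω) * algebraMap K Ω (coeff (n + k) g) * t ^ n)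
      (coeff k (expandAt g t)) := by
  obtain ⟨s, hs1, hs2⟩ := exists_between ht
  have hs : 0 < s := (norm_nonneg t).trans_lt hs1
  obtain ⟨C, hC0, hC⟩ := hg.exists_le hs.le hs2
  rw [expandAt, coeff_mk]
  refine Summable.hasSum (Summable.of_norm_bounded (g := fun n => C / s ^ k * (‖t‖ / s) ^ n)
    ((summable_geometric_of_lt_one (by positivity) ((div_lt_one hs).2 hs1)).mul_left _) fun n => ?_)
  rw [mul_assoc]
  refine (norm_natCast_mul_le _ _).trans ?_
  rw [norm_mul, norm_algebraMap', norm_pow, div_pow, div_mul_div_comm, le_div_iff₀ (by positivity)]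
  calc ‖coeff (n + k) g‖ * ‖t‖ ^ n * (s ^ k * s ^ n)
      = (‖coeff (n + k) g‖ * s ^ (n + k)) * ‖t‖ ^ n := by ring
    _ ≤ C * ‖t‖ ^ n := mul_le_mul_of_nonneg_right (hC _) (by positivity)

-- Hasse derivatives of truncations give the partial sums of the expansion at `t`. This reduces
-- questions at `t` to polynomials, the only functions `LiesOver` speaks of.
omit [CompleteSpace Ω] in
theorem aeval_hasseDeriv_trunc (g : K⟦X⟧) (k N : ℕ) (t : Ω) :
    Polynomial.aeval t (Polynomial.hasseDeriv k (trunc (N + k) g)) =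
      ∑ n ∈ Finset.range N,
        ((n + k).choose k : Ω) * algebraMap K Ω (coeff (n + k) g) * t ^ n := by
  induction N with
  | zero =>
    rw [zero_add, Finset.sum_range_zero]
    have : Polynomial.hasseDeriv k (trunc k g) = 0 := by
      ext n
      rw [Polynomial.hasseDeriv_coeff, coeff_trunc, if_neg (by omega), mul_zero,
        Polynomial.coeff_zero]
    rw [this, map_zero]
  | succ N ih =>
    rw [Finset.sum_range_succ, ← ih, show N + 1 + k = (N + k) + 1 by ring, trunc_succ, map_add,
      map_add, Polynomial.hasseDeriv_monomial, Polynomial.aeval_monomial, map_mul, map_natCast,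
      Nat.add_sub_cancel]

theorem tendsto_aeval_hasseDeriv_trunc [IsUltrametricDist Ω] {g : K⟦X⟧} {r : ℝ}
    (hg : IsAnalyticOnDisc g r) (ht : ‖t‖ < r) (k : ℕ) :
    Tendsto (fun N => Polynomial.aeval t (Polynomial.hasseDeriv k (trunc N g))) atTop
      (𝓝 (coeff k (expandAt g t))) := by
  rw [← tendsto_add_atTop_iff_nat k]
  simp only [aeval_hasseDeriv_trunc]
  exact (hasSum_coeff_expandAt hg ht k).tendsto_sum_nat

/-- The coefficients of the formal solution at a generic point of a disc are at least as big as
those at the center. -/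
theorem LiesOver.norm_odeSeq_le [IsUltrametricDist Ω] {g : K⟦X⟧} {r : ℝ}
    (hg : IsAnalyticOnDisc g r) (ht : ‖t‖ < r) (h : LiesOver (K := K) t ρ) (k : ℕ) :
    ‖odeSeq (fun i => coeff i g) k‖ ≤ ‖odeSeq (fun i => coeff i (expandAt g t)) k‖ := by
  refine ge_of_tendsto
    (tendsto_odeSeq (fun i => tendsto_aeval_hasseDeriv_trunc hg ht i) k).norm ?_
  filter_upwards [eventually_ge_atTop k] with N hN
  -- Running the recursion in K[T] yields one polynomial: its value at `t` is z_k of the truncation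
  -- at `t`, and its constant term is z_k at 0, since k ≤ N hides the truncation.
  let P : Polynomial K := odeSeq (fun i => Polynomial.hasseDeriv i (trunc N g)) k
  have e1 : odeSeq (fun i => Polynomial.aeval t (Polynomial.hasseDeriv i (trunc N g))) k =
      Polynomial.aeval t P :=
    (map_odeSeq (Polynomial.aeval t : Polynomial K →ₐ[K] Ω).toRingHom _ k).symm
  have e2 : odeSeq (fun i => coeff i g) k = P.coeff 0 := by
    have := map_odeSeq (Polynomial.constantCoeff (R := K))
      (fun i => Polynomial.hasseDeriv i (trunc N g)) k
    rw [← Polynomial.constantCoeff_apply, this]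
    refine odeSeq_congr fun i hi => ?_
    rw [Polynomial.constantCoeff_apply, Polynomial.hasseDeriv_coeff, zero_add, Nat.choose_self,
      Nat.cast_one, one_mul, coeff_trunc, if_pos (by omega)]
  rw [e1, e2]
  exact h.norm_coeff_zero_le P

/-- All truncations that contain the index `i` have Gauss norm exactly `M`, and |g(t)| is the limit
of their norms at `t`. -/
theorem LiesOver.norm_coeff_zero_expandAt [IsUltrametricDist Ω] {g : K⟦X⟧} {r M : ℝ}
    (hρ : 0 ≤ ρ) (hg : IsAnalyticOnDisc g r) (hr : ρ < r) (h : LiesOver (K := K) t ρ)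
    (hM : ∀ i, ‖coeff i g‖ * ρ ^ i ≤ M) {i : ℕ} (hi : ‖coeff i g‖ * ρ ^ i = M) :
    ‖coeff 0 (expandAt g t)‖ = M := by
  have ht := h.norm_eq hρ
  refine tendsto_nhds_unique
    (tendsto_aeval_hasseDeriv_trunc hg (ht.trans_lt hr) 0).norm (tendsto_const_nhds.congr' ?_)
  filter_upwards [eventually_gt_atTop i] with N hN
  rw [Polynomial.hasseDeriv_zero', h]
  symm
  refine gaussPoint_eq (i := i) (fun j => ?_) ?_
  · rw [Polynomial.coeff_coe, coeff_trunc]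
    split_ifs
    · exact hM j
    · rw [norm_zero, zero_mul, ← hi]; positivity
  · rw [Polynomial.coeff_coe, coeff_trunc, if_pos hN, hi]

end LiesOver

/-! ## Radii of convergence -/

section Radius

theorem charZero_of_normedAlgebra_padic (p : ℕ) [Fact p.Prime] (Ω : Type*) [NormedField Ω]
    [NormedAlgebra ℚ_[p] Ω] : CharZero Ω :=
  charZero_of_injective_algebraMap (algebraMap ℚ_[p] Ω).injective

variable {p : ℕ} [hpf : Fact p.Prime] {Ω : Type*} [NormedField Ω] [NormedAlgebra ℚ_[p] Ω]
  [IsUltrametricDist Ω]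

theorem isTrivialOnDisc_of_norm_le {g : ℚ_[p]⟦X⟧} {t : Ω} {G : ℝ} (hG : 0 < G)
    (h : ∀ i, ‖coeff i (expandAt g t)‖ ≤ G ^ (i + 1)) :
    IsTrivialOnDisc g t (omega p / G) := by
  have := charZero_of_normedAlgebra_padic p Ω
  exact ⟨odeSol (expandAt g t), odeSol (-expandAt g t), isAnalyticOnDisc_odeSol hG h,
    isAnalyticOnDisc_odeSol hG (by simpa using h), odeSol_mul_odeSol_neg _, derivative_odeSol _⟩

omit [IsUltrametricDist Ω] in
-- A trivialization is a multiple of the formal solution, by a nonzero constant because it is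
-- invertible.
theorem IsTrivialOnDisc.isAnalyticOnDisc_odeSol [CharZero Ω] {g : ℚ_[p]⟦X⟧} {t : Ω} {r : ℝ}
    (h : IsTrivialOnDisc g t r) : IsAnalyticOnDisc (odeSol (expandAt g t)) r := by
  obtain ⟨Y, Z, hY, -, hYZ, hd⟩ := h
  have h0 : constantCoeff Y ≠ 0 := by
    intro h0
    have := congrArg constantCoeff hYZ
    rw [map_mul, h0, zero_mul, map_one] at this
    exact zero_ne_one this
  have hY' := eq_C_mul_odeSol hd
  intro s hs hsr
  have h1 := (hY s hs hsr).const_mul ‖constantCoeff Y‖⁻¹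
  rw [mul_zero] at h1
  refine h1.congr fun i => ?_
  rw [hY']
  simp only [PowerSeries.coeff_C_mul, norm_mul, map_mul, constantCoeff_C, constantCoeff_odeSol,
    mul_one]
  have := norm_ne_zero_iff.2 h0
  field_simp

/-- If the first coefficient dominates, the radius of convergence of the solution is `ω / G`. -/
theorem not_isAnalyticOnDisc_odeSol {g : Ω⟦X⟧} {G r : ℝ} (hG : 0 < G)
    (h0 : ‖coeff 0 g‖ = G) (h : ∀ i, 1 ≤ i → ‖coeff i g‖ < G ^ (i + 1)) (hr : omega p / G < r) :
    ¬ IsAnalyticOnDisc (odeSol g) r := by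
  intro han
  have hw := omega_pos p
  have h1 := han _ (div_pos hw hG).le hr
  have h2 := h1.comp (tendsto_pow_atTop_atTop_of_one_lt hpf.out.one_lt)
  -- At radius ω/G all the terms of degree p^j have norm ω.
  refine hw.ne (tendsto_nhds_unique h2 (tendsto_const_nhds.congr fun j => ?_))
  rw [Function.comp_apply, coeff_odeSol, norm_div, norm_natCast_eq (p := p), norm_factorial_pow,
    norm_odeSeq_eq hG h0 h, div_pow]
  have h3 : omega p ^ p ^ j = omega p ^ (p ^ j - 1) * omega p := by
    rw [← pow_succ, Nat.sub_add_cancel (Nat.one_le_pow _ _ hpf.out.pos)]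
  rw [h3]
  field_simp

end Radius

/-! ### The radius of the module below and above r_0. -/

section GammaRadius

variable {p : ℕ} [hpf : Fact p.Prime] {g : ℚ_[p]⟦X⟧} (hg : HasGammaCoeffs g)
include hg

/-- The solution at the origin does not converge on a disc of radius greater than `ω r_0`. -/
theorem HasGammaCoeffs.le_of_isAnalyticOnDisc (hp : 3 ≤ p) {r : ℝ}
    (h : IsAnalyticOnDisc (odeSol g) r) : r ≤ omega p * breakRadius p 0 := by
  by_contra! hr
  have hp0 := natCast_pos p
  have hw := omega_pos p
  have hb := breakRadius_pos p 0
  let b : ℚ_[p] := coeff (p - 1) g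
  have hb1 : ‖b‖ = p := by simpa using hg.norm_eq 0
  -- `odeSol g * odeSol g₁` is exp(bT^p/p); the second factor sees only the non-dominant
  -- coefficients and converges beyond ω r_0.
  let g₁ : ℚ_[p]⟦X⟧ := C b * X ^ (p - 1) - g
  obtain ⟨σ, hσ, hσ'⟩ : ∃ σ : ℝ, breakRadius p 0 < σ ∧ σ ^ (2 * p + 1) ≤ ((p : ℝ)⁻¹) ^ 2 := by
    have h1 : breakRadius p 0 ^ (2 * p + 1) < ((p : ℝ)⁻¹) ^ 2 := by
      rw [pow_succ, mul_comm 2 p, pow_mul, breakRadius_zero_pow]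
      exact mul_lt_of_lt_one_right (by positivity) (lt_one_of_le_breakRadius le_rfl)
    have h2 : ∀ᶠ x in 𝓝[>] breakRadius p 0, x ^ (2 * p + 1) < ((p : ℝ)⁻¹) ^ 2 :=
      (((continuous_pow (2 * p + 1)).tendsto _).eventually (gt_mem_nhds h1)).filter_mono
        nhdsWithin_le_nhds
    obtain ⟨σ, h3, h4⟩ := (h2.and self_mem_nhdsWithin).exists
    exact ⟨σ, h4, h3.le⟩
  have hσ0 : 0 < σ := hb.trans hσ
  have h1 : IsAnalyticOnDisc (odeSol g₁) (omega p * σ) := by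
    have := MoritaGamma.isAnalyticOnDisc_odeSol (p := p) (g := g₁) (inv_pos.2 hσ0) fun i => ?_
    · rwa [div_inv_eq_mul] at this
    · rw [inv_pow, ← one_div, le_div_iff₀ (by positivity)]
      by_cases hi : i = p - 1
      · simp [g₁, hi, b, PowerSeries.coeff_X_pow]
      · simp only [g₁, map_sub, PowerSeries.coeff_C_mul, PowerSeries.coeff_X_pow, if_neg hi,
          mul_zero, zero_sub, norm_neg]
        exact hg.mul_pow_le_one_of_ne hp hσ0.le hσ' hi
  set R := min r (omega p * σ) with hR
  have hRlt : omega p * breakRadius p 0 < R := lt_min hr (by gcongr)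
  have h2 : IsAnalyticOnDisc (odeSol (C b * X ^ (p - 1))) R := by
    have := (h.mono (min_le_left r (omega p * σ))).mul (h1.mono (min_le_right r (omega p * σ)))
    rwa [odeSol_mul_odeSol, show g + g₁ = C b * X ^ (p - 1) by simp [g₁]] at this
  have h3 : ∀ m : ℕ, coeff (p * m) (odeSol (C b * X ^ (p - 1))) =
      (b / p) ^ m / (m.factorial : ℚ_[p]) := by
    intro m
    induction m with
    | zero => simp [odeSeq]
    | succ m ih =>
      have := congrArg (coeff (p * m + (p - 1))) (derivative_odeSol (C b * X ^ (p - 1)))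
      rw [PowerSeries.coeff_derivative, mul_assoc, PowerSeries.coeff_C_mul,
        PowerSeries.coeff_X_pow_mul, ih] at this
      have h4 : p * m + (p - 1) + 1 = p * (m + 1) := by
        rw [mul_add, mul_one]; omega
      have h5 : ((p * m + (p - 1) : ℕ) : ℚ_[p]) + 1 = p * (m + 1) := by
        rw [← Nat.cast_succ, Nat.succ_eq_add_one, h4]; push_cast; rfl
      rw [h4, h5] at this
      have h6 : (m + 1 : ℚ_[p]) ≠ 0 := by exact_mod_cast Nat.succ_ne_zero m
      have h7 : (p : ℚ_[p]) ≠ 0 := by exact_mod_cast hpf.out.ne_zero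
      have h8 : (m.factorial : ℚ_[p]) ≠ 0 := by exact_mod_cast m.factorial_ne_zero
      rw [← mul_right_inj' (mul_ne_zero h7 h6), mul_comm, this, Nat.factorial_succ]
      push_cast
      rw [pow_succ]
      field_simp
  have h4 := h2 _ (by positivity) hRlt
  -- In degree p·m with m = p^j, the term at radius ω r_0 has norm p^{2m}(ω^p p^{-1})^m/|m!|. As ω^p
  -- = ω/p, this is ω^m/ω^{m-1} = ω.
  have h5 := h4.comp ((tendsto_pow_atTop_atTop_of_one_lt hpf.out.one_lt).comp (tendsto_add_atTop_nat 1))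
  refine hw.ne (tendsto_nhds_unique h5 (tendsto_const_nhds.congr fun j => ?_))
  simp only [Function.comp_apply]
  rw [pow_succ', h3, norm_div, norm_pow, norm_div, hb1, Padic.norm_p, div_inv_eq_mul,
    norm_factorial_pow, pow_mul _ p, mul_pow _ _ p, breakRadius_zero_pow]
  have h6 : omega p ^ p ^ j = omega p ^ (p ^ j - 1) * omega p := by
    rw [← pow_succ, Nat.sub_add_cancel (Nat.one_le_pow _ _ hpf.out.pos)]
  have h7 : omega p ^ p = (p : ℝ)⁻¹ * omega p := by
    rw [← omega_pow, ← pow_succ, Nat.sub_add_cancel hpf.out.one_le]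
  rw [h7, div_mul_eq_mul_div, ← mul_pow,
    show (p : ℝ) * p * ((p : ℝ)⁻¹ * omega p * (p : ℝ)⁻¹) = omega p by field_simp, h6]
  field_simp

theorem HasGammaCoeffs.isRadiusAt_of_le (hp : 3 ≤ p) {Ω : Type*} [NormedField Ω]
    [NormedAlgebra ℚ_[p] Ω] [IsUltrametricDist Ω] [CompleteSpace Ω] {t : Ω} {ρ : ℝ} (hρ : 0 ≤ ρ)
    (ht : LiesOver (K := ℚ_[p]) t ρ) (h : ρ ≤ breakRadius p 0) :
    IsRadiusAt g t (omega p * breakRadius p 0) := by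
  have := charZero_of_normedAlgebra_padic p Ω
  have hb := breakRadius_pos p 0
  have hw := omega_pos p
  have hb1 : breakRadius p 0 < 1 := lt_one_of_le_breakRadius le_rfl
  have hnt := ht.norm_eq hρ
  have hbound : ∀ i, ‖coeff i (expandAt g t)‖ ≤ (breakRadius p 0)⁻¹ ^ (i + 1) := by
    refine fun i => norm_coeff_expandAt_le fun n => ?_
    rw [hnt, inv_pow, ← one_div, le_div_iff₀ (by positivity)]
    refine le_trans ?_ (hg.mul_pow_le_one hp hb.le (breakRadius_zero_pow p).le (n + i))
    rw [mul_assoc]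
    gcongr
    calc ρ ^ n * breakRadius p 0 ^ (i + 1) ≤ breakRadius p 0 ^ n * breakRadius p 0 ^ (i + 1) := by
          gcongr
      _ = breakRadius p 0 ^ (n + i + 1) := by rw [← pow_add, add_assoc]
  have htriv := isTrivialOnDisc_of_norm_le (inv_pos.2 hb) hbound
  rw [div_inv_eq_mul] at htriv
  refine ⟨⟨by positivity, mul_le_one₀ (omega_lt_one p).le hb.le hb1.le, htriv⟩, ?_⟩
  rintro r ⟨hr0, -, hr⟩
  -- The coefficients at the origin are bounded by those at `t`, so convergence at `t` gives
  -- convergence at the origin.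
  refine hg.le_of_isAnalyticOnDisc hp fun s hs hsr => ?_
  refine squeeze_zero (fun i => by positivity) (fun i => ?_) (hr.isAnalyticOnDisc_odeSol s hs hsr)
  refine mul_le_mul_of_nonneg_right ?_ (by positivity)
  rw [coeff_odeSol, coeff_odeSol, norm_div, norm_div, norm_natCast_eq (p := p) (Ω := Ω)]
  refine div_le_div_of_nonneg_right ?_ (norm_nonneg _)
  exact ht.norm_odeSeq_le hg.isAnalyticOnDisc (hnt.trans_lt (h.trans_lt hb1)) i

theorem HasGammaCoeffs.isRadiusAt_of_lt (hp : 3 ≤ p) {Ω : Type*} [NormedField Ω]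
    [NormedAlgebra ℚ_[p] Ω] [IsUltrametricDist Ω] [CompleteSpace Ω] {t : Ω} {ρ : ℝ}
    (ht : LiesOver (K := ℚ_[p]) t ρ) (h : breakRadius p 0 < ρ) {N : ℕ}
    (hlow : breakRadius p N ≤ ρ) (hupp : ρ ≤ breakRadius p (N + 1)) :
    IsRadiusAt g t (omega p / ((p : ℝ) ^ (N + 1) * ρ ^ (p ^ N * (p - 1)))) := by
  have := charZero_of_normedAlgebra_padic p Ω
  have hp0 := natCast_pos p
  have hw := omega_pos p
  have hρ : 0 < ρ := (breakRadius_pos p 0).trans h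
  have hρ1 : ρ < 1 := lt_one_of_le_breakRadius hupp
  have hnt := ht.norm_eq hρ.le
  have hGρ := one_lt_dominant_mul hp h hlow hupp
  have hle := hg.mul_pow_le hp hlow hupp
  have heq : ‖coeff (p ^ N * (p - 1)) g‖ * ρ ^ (p ^ N * (p - 1)) =
      (p : ℝ) ^ (N + 1) * ρ ^ (p ^ N * (p - 1)) := by rw [hg.norm_eq]
  set G := (p : ℝ) ^ (N + 1) * ρ ^ (p ^ N * (p - 1)) with hG
  have hG0 : 0 < G := by positivity
  have hG0' : ‖coeff 0 (expandAt g t)‖ = G :=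
    ht.norm_coeff_zero_expandAt hρ.le hg.isAnalyticOnDisc hρ1 hle heq
  have hGi : ∀ i, ‖coeff i (expandAt g t)‖ ≤ G / ρ ^ i := by
    refine fun i => norm_coeff_expandAt_le fun n => ?_
    rw [hnt, le_div_iff₀ (by positivity), mul_assoc, ← pow_add]
    exact hle _
  -- This is Gρ > 1 raised to the power `i`.
  have hlt : ∀ i, 1 ≤ i → G / ρ ^ i < G ^ (i + 1) := by
    intro i hi
    rw [div_lt_iff₀ (by positivity), pow_succ', mul_assoc, ← mul_pow]
    exact lt_mul_of_one_lt_right hG0 (one_lt_pow₀ hGρ (by omega))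
  have hbound : ∀ i, ‖coeff i (expandAt g t)‖ ≤ G ^ (i + 1) := by
    intro i
    rcases Nat.eq_zero_or_pos i with rfl | hi
    · rw [hG0', zero_add, pow_one]
    · exact (hGi i).trans (hlt i hi).le
  refine ⟨⟨by positivity, ?_, isTrivialOnDisc_of_norm_le hG0 hbound⟩, ?_⟩
  · rw [div_le_one hG0]
    refine (omega_lt_one p).le.trans (hGρ.le.trans (mul_le_of_le_one_right hG0.le hρ1.le))
  · rintro r ⟨-, -, hr⟩
    by_contra! hlt'
    exact not_isAnalyticOnDisc_odeSol (p := p) hG0 hG0' (fun i hi => (hGi i).trans_lt (hlt i hi))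
      hlt' hr.isAnalyticOnDisc_odeSol

theorem HasGammaCoeffs.isRadiusAt (hp : 3 ≤ p) {Ω : Type*} [NormedField Ω]
    [NormedAlgebra ℚ_[p] Ω] [IsUltrametricDist Ω] [CompleteSpace Ω] {t : Ω} {ρ : ℝ}
    (ht : LiesOver (K := ℚ_[p]) t ρ) {N : ℕ}
    (hlow : breakRadius p N ≤ ρ) (hupp : ρ ≤ breakRadius p (N + 1)) :
    IsRadiusAt g t (omega p / ((p : ℝ) ^ (N + 1) * ρ ^ (p ^ N * (p - 1)))) := by
  have hp0 := natCast_pos p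
  have hρ : 0 < ρ := (breakRadius_pos p N).trans_le hlow
  rcases lt_or_ge (breakRadius p 0) ρ with h | h
  · exact hg.isRadiusAt_of_lt hp ht h hlow hupp
  -- Only ρ = r_0 remains; there the dominant term equals 1/ρ and the two formulas agree.
  · have h1 := hg.isRadiusAt_of_le hp hρ.le ht h
    have h2 := le_pow_self_of_breakRadius_le hp (lt_one_of_le_breakRadius h) hlow
    rw [← breakRadius_zero_pow p] at h2
    have h3 : ρ = breakRadius p 0 := h.antisymm (le_of_pow_le_pow_left₀ hpf.out.ne_zero hρ.le h2)
    have h4 := one_le_dominant_mul hp hlow hupp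
    have h5 := hg.mul_pow_le_one hp hρ.le (by rw [h3, breakRadius_zero_pow]) (p ^ N * (p - 1))
    rw [hg.norm_eq, pow_succ ρ, ← mul_assoc] at h5
    have h6 := h5.antisymm h4
    rwa [eq_div_of_mul_eq hρ.ne' h6, one_div, div_inv_eq_mul, h3]

end GammaRadius

/-! ## The expansion of the logarithmic derivative -/

section Arithmetic

variable {p : ℕ} [hpf : Fact p.Prime]

omit hpf in
theorem norm_sub_le_max_of_ultrametric {E : Type*} [SeminormedAddCommGroup E]
    [IsUltrametricDist E] (x y : E) : ‖x - y‖ ≤ max ‖x‖ ‖y‖ := by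
  rw [sub_eq_add_neg, ← norm_neg y]
  exact IsUltrametricDist.norm_add_le_max _ _

theorem norm_le_inv_of_lt_one {x : ℚ_[p]} (h : ‖x‖ < 1) : ‖x‖ ≤ (p : ℝ)⁻¹ := by
  rw [← zpow_neg_one, Padic.norm_le_pow_iff_norm_lt_pow_add_one]
  simpa using h

theorem inv_natCast_lt_one : (p : ℝ)⁻¹ < 1 := inv_lt_one_of_one_lt₀ (one_lt_natCast p)

theorem norm_inv_natCast_le (k : ℕ) : ‖(k : ℚ_[p])⁻¹‖ ≤ k := by
  rcases Nat.eq_zero_or_pos k with rfl | hk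
  · simp
  obtain ⟨v, c, hc, hkc⟩ := Nat.exists_eq_pow_mul_and_not_dvd hk.ne' p hpf.out.ne_one
  have h1 : ‖(k : ℚ_[p])‖ = ((p : ℝ) ^ v)⁻¹ := by rw [hkc, norm_natCast_pow_mul hc]
  rw [norm_inv, h1, inv_inv]
  exact_mod_cast Nat.le_of_dvd hk ⟨c, hkc⟩

theorem norm_natCast_inv_eq_one {j : ℕ} (hj : ¬ p ∣ j) : ‖(j : ℚ_[p])⁻¹‖ = 1 := by
  rw [norm_inv, Padic.norm_natCast_eq_one_iff.2 ((Nat.Prime.coprime_iff_not_dvd hpf.out).2 hj),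
    inv_one]

theorem norm_two_inv (hp : 3 ≤ p) : ‖(2 : ℚ_[p])⁻¹‖ = 1 := by
  have := norm_natCast_inv_eq_one (p := p) (j := 2) fun h => by
    have := Nat.le_of_dvd (by norm_num) h
    omega
  exact_mod_cast this

/-- For even index this is von Staudt–Clausen. For odd index only B_1 = -1/2 is nonzero, and 2 is a
unit. -/
theorem norm_bernoulli_le (hp : 3 ≤ p) (m : ℕ) : ‖((bernoulli m : ℚ) : ℚ_[p])‖ ≤ p := by
  have hp1 := one_lt_natCast p
  rcases Nat.even_or_odd' m with ⟨k, rfl | rfl⟩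
  · obtain ⟨z, hz⟩ := Bernoulli.vonStaudt_clausen k
    rw [eq_comm, ← eq_sub_iff_add_eq] at hz
    rw [hz]
    push_cast
    refine (norm_sub_le_max_of_ultrametric _ _).trans (max_le ?_ ?_)
    · exact (Padic.norm_int_le_one z).trans hp1.le
    · refine IsUltrametricDist.norm_sum_le_of_forall_le_of_nonneg (by positivity) fun q hq => ?_
      rw [Finset.mem_filter] at hq
      rw [one_div]
      by_cases hqp : q = p
      · rw [hqp, norm_inv, Padic.norm_p, inv_inv]
      · rw [norm_natCast_inv_eq_one fun h => hqp ((Nat.prime_dvd_prime_iff_eq hpf.out hq.2.1).1 h).symm]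
        exact hp1.le
  · rcases Nat.eq_zero_or_pos k with rfl | hk
    · simp only [mul_zero, zero_add, bernoulli_one]
      push_cast
      rw [norm_div, norm_neg, norm_one, one_div, ← norm_inv, norm_two_inv hp]
      exact hp1.le
    · rw [bernoulli_eq_zero_of_odd ⟨k, rfl⟩ (by omega)]
      simp

variable (p) in
/-- The sum of the `k`-th powers of the inverses of `1, …, p - 1`. -/
def invPowerSum (k : ℕ) : ℚ_[p] := ∑ j ∈ Finset.Ico 1 p, ((j : ℚ_[p])⁻¹) ^ k

omit hpf in
theorem not_dvd_of_mem_Ico {j : ℕ} (hj : j ∈ Finset.Ico 1 p) : ¬ p ∣ j := by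
  rw [Finset.mem_Ico] at hj
  exact Nat.not_dvd_of_pos_of_lt hj.1 hj.2

theorem norm_invPowerSum_le_one (k : ℕ) : ‖invPowerSum p k‖ ≤ 1 := by
  refine IsUltrametricDist.norm_sum_le_of_forall_le_of_nonneg zero_le_one fun j hj => ?_
  rw [norm_pow, norm_natCast_inv_eq_one (not_dvd_of_mem_Ico hj), one_pow]

theorem sum_Ico_pow_zmod (l : ℕ) :
    ∑ v ∈ Finset.Ico 1 p, (v : ZMod p) ^ l = if (p - 1) ∣ l then -1 else 0 := by
  have hbij : (∑ v ∈ Finset.Ico 1 p, (v : ZMod p) ^ l) = ∑ u : (ZMod p)ˣ, (u : ZMod p) ^ l :=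
    Finset.sum_bij'
      (fun v hv => Units.mk0 (v : ZMod p)
        (mt (ZMod.natCast_eq_zero_iff v p).mp (not_dvd_of_mem_Ico hv)))
      (fun u _ => (u : ZMod p).val)
      (fun _ _ => Finset.mem_univ _)
      (fun u _ => Finset.mem_Ico.2 ⟨Nat.pos_of_ne_zero ((ZMod.val_ne_zero _).2 u.ne_zero),
        ZMod.val_lt _⟩)
      (fun v hv => by simp [ZMod.val_cast_of_lt (Finset.mem_Ico.mp hv).2])
      (fun u _ => Units.ext (ZMod.natCast_zmod_val _))
      (fun _ _ => rfl)
  rw [hbij, FiniteField.sum_pow_units, ZMod.card]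

/-- By Fermat, 1/j ≡ j^{p-2} mod p, which reduces the sum to a power sum over the units of 𝔽_p. -/
theorem norm_invPowerSum_sub_lt_one (k : ℕ) :
    ‖invPowerSum p k - ((∑ j ∈ Finset.Ico 1 p, j ^ (k * (p - 2)) : ℕ) : ℚ_[p])‖ < 1 := by
  have hp2 := hpf.out.two_le
  rw [invPowerSum, Nat.cast_sum, ← Finset.sum_sub_distrib]
  refine lt_of_le_of_lt ?_ (inv_natCast_lt_one (p := p))
  refine IsUltrametricDist.norm_sum_le_of_forall_le_of_nonneg (by positivity) fun j hj => ?_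
  apply norm_le_inv_of_lt_one
  have hj0 : (j : ℚ_[p]) ≠ 0 := by
    rw [Finset.mem_Ico] at hj
    exact_mod_cast (by omega : j ≠ 0)
  have h1 : ((j : ℚ_[p])⁻¹) ^ k - ((j ^ (k * (p - 2)) : ℕ) : ℚ_[p]) =
      ((j : ℚ_[p])⁻¹) ^ k * ((1 - (j : ℤ) ^ ((p - 1) * k) : ℤ) : ℚ_[p]) := by
    have : (p - 1) * k = k + k * (p - 2) := by
      rw [show p - 1 = 1 + (p - 2) by omega]; ring
    push_cast
    rw [mul_sub, mul_one, this, pow_add (j : ℚ_[p]), ← mul_assoc, ← mul_pow, inv_mul_cancel₀ hj0,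
      one_pow, one_mul]
  rw [h1, norm_mul, norm_pow, norm_natCast_inv_eq_one (not_dvd_of_mem_Ico hj), one_pow, one_mul,
    Padic.norm_intCast_lt_one_iff, ← ZMod.intCast_zmod_eq_zero_iff_dvd]
  push_cast
  rw [pow_mul, ZMod.pow_card_sub_one_eq_one, one_pow, sub_self]
  exact mt (ZMod.natCast_eq_zero_iff j p).mp (not_dvd_of_mem_Ico hj)

omit hpf in
theorem sub_one_dvd_mul_iff (hp : 3 ≤ p) (k : ℕ) : (p - 1) ∣ k * (p - 2) ↔ (p - 1) ∣ k := by
  have : Nat.Coprime (p - 1) (p - 2) := by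
    rw [show p - 1 = (p - 2) + 1 by omega]
    simp
  exact ⟨fun h => this.dvd_of_dvd_mul_right h, fun h => h.mul_right _⟩

theorem norm_invPowerSum_of_dvd (hp : 3 ≤ p) {k : ℕ} (hk : (p - 1) ∣ k) :
    ‖invPowerSum p k‖ = 1 := by
  refine (norm_invPowerSum_le_one k).eq_of_not_lt fun h => ?_
  have h1 := norm_invPowerSum_sub_lt_one (p := p) k
  have h2 : ‖((∑ j ∈ Finset.Ico 1 p, j ^ (k * (p - 2)) : ℕ) : ℚ_[p])‖ < 1 := by
    rw [← sub_sub_cancel (invPowerSum p k)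
      ((∑ j ∈ Finset.Ico 1 p, j ^ (k * (p - 2)) : ℕ) : ℚ_[p])]
    exact (norm_sub_le_max_of_ultrametric _ _).trans_lt (max_lt h h1)
  rw [Padic.norm_natCast_lt_one_iff, ← ZMod.natCast_eq_zero_iff] at h2
  push_cast at h2
  rw [sum_Ico_pow_zmod, if_pos ((sub_one_dvd_mul_iff hp k).2 hk)] at h2
  simp at h2

theorem norm_invPowerSum_of_not_dvd (hp : 3 ≤ p) {k : ℕ} (hk : ¬ (p - 1) ∣ k) :
    ‖invPowerSum p k‖ ≤ (p : ℝ)⁻¹ := by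
  apply norm_le_inv_of_lt_one
  have h1 := norm_invPowerSum_sub_lt_one (p := p) k
  have h2 : ‖((∑ j ∈ Finset.Ico 1 p, j ^ (k * (p - 2)) : ℕ) : ℚ_[p])‖ < 1 := by
    rw [Padic.norm_natCast_lt_one_iff, ← ZMod.natCast_eq_zero_iff]
    push_cast
    rw [sum_Ico_pow_zmod, if_neg (mt (sub_one_dvd_mul_iff hp k).1 hk)]
  rw [← sub_add_cancel (invPowerSum p k)
    ((∑ j ∈ Finset.Ico 1 p, j ^ (k * (p - 2)) : ℕ) : ℚ_[p])]
  exact (IsUltrametricDist.norm_add_le_max _ _).trans_lt (max_lt h1 h2)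

variable (p) in
/-- The `k`-th coefficient of `∑_{1 ≤ j < p} log (1 + T / j)`. -/
def logProdCoeff (k : ℕ) : ℚ_[p] := (-1) ^ (k + 1) * invPowerSum p k * (k : ℚ_[p])⁻¹

theorem norm_logProdCoeff_le (k : ℕ) : ‖logProdCoeff p k‖ ≤ k := by
  rw [logProdCoeff, norm_mul, norm_mul, norm_pow, norm_neg, norm_one, one_pow, one_mul]
  calc _ ≤ 1 * (k : ℝ) := mul_le_mul (norm_invPowerSum_le_one k) (norm_inv_natCast_le k)
        (norm_nonneg _) zero_le_one
    _ = k := one_mul _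

variable (p) in
/-- The factor `B_m p^{m-1}`. -/
def bernoulliFactor (m : ℕ) : ℚ_[p] := ((bernoulli m : ℚ) : ℚ_[p]) * ((p : ℚ_[p]) ^ m / p)

theorem norm_bernoulliFactor_le (hp : 3 ≤ p) (m : ℕ) :
    ‖bernoulliFactor p m‖ ≤ (p : ℝ) ^ 2 * ((p : ℝ)⁻¹) ^ m := by
  rw [bernoulliFactor, norm_mul, norm_div, norm_pow, Padic.norm_p, div_inv_eq_mul]
  calc _ ≤ (p : ℝ) * (((p : ℝ)⁻¹) ^ m * p) :=
        mul_le_mul_of_nonneg_right (norm_bernoulli_le hp m) (by positivity)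
    _ = _ := by ring

/-- For m = 1 the factor is -1/2; for m ≥ 2 the power p^{m-1} absorbs the denominator of B_m. -/
theorem norm_bernoulliFactor_le_one (hp : 3 ≤ p) {m : ℕ} (hm : 1 ≤ m) :
    ‖bernoulliFactor p m‖ ≤ 1 := by
  have hp0 := natCast_pos p
  rcases hm.eq_or_lt with rfl | hm
  · rw [bernoulliFactor, pow_one, div_self (by exact_mod_cast hpf.out.ne_zero), mul_one,
      bernoulli_one]
    push_cast
    rw [norm_div, norm_neg, norm_one, one_div, ← norm_inv, norm_two_inv hp]
  · refine (norm_bernoulliFactor_le hp m).trans ?_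
    have : ((p : ℝ)⁻¹) ^ m ≤ ((p : ℝ)⁻¹) ^ 2 :=
      pow_le_pow_of_le_one (by positivity) inv_natCast_lt_one.le (by omega)
    calc (p : ℝ) ^ 2 * ((p : ℝ)⁻¹) ^ m ≤ (p : ℝ) ^ 2 * ((p : ℝ)⁻¹) ^ 2 := by gcongr
      _ = 1 := by rw [← mul_pow, mul_inv_cancel₀ hp0.ne', one_pow]

theorem bernoulliFactor_zero : bernoulliFactor p 0 = (p : ℚ_[p])⁻¹ := by
  simp [bernoulliFactor]

variable (p) in
/-- The terms of the `i`-th coefficient of the logarithmic derivative. -/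
def logDerivTerm (i m : ℕ) : ℚ_[p] :=
  logProdCoeff p (m + i) * (m + i).choose i * bernoulliFactor p m

variable (p) in
/-- The logarithmic derivative of the Gamma function, up to a constant. -/
def logDerivSeries : ℚ_[p]⟦X⟧ := PowerSeries.mk fun i => ∑' m, logDerivTerm p i m

theorem norm_logDerivTerm_le (hp : 3 ≤ p) (i m : ℕ) :
    ‖logDerivTerm p i m‖ ≤ (m + i : ℕ) * ((p : ℝ) ^ 2 * ((p : ℝ)⁻¹) ^ m) := by
  rw [logDerivTerm, mul_comm (logProdCoeff _ _), mul_assoc]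
  refine (norm_natCast_mul_le _ _).trans ?_
  rw [norm_mul]
  exact mul_le_mul (norm_logProdCoeff_le _) (norm_bernoulliFactor_le hp m) (norm_nonneg _)
    (Nat.cast_nonneg _)

theorem summable_natCast_add_mul_pow (i : ℕ) :
    Summable fun m : ℕ => ((m + i : ℕ) : ℝ) * ((p : ℝ) ^ 2 * ((p : ℝ)⁻¹) ^ m) := by
  have hlt : ‖(p : ℝ)⁻¹‖ < 1 := by
    rw [Real.norm_of_nonneg (by positivity)]; exact inv_natCast_lt_one
  have h1 := ((summable_pow_mul_geometric_of_norm_lt_one 1 hlt).mul_left ((p : ℝ) ^ 2)).add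
    ((summable_pow_mul_geometric_of_norm_lt_one 0 hlt).mul_left ((p : ℝ) ^ 2 * i))
  refine h1.congr fun m => ?_
  push_cast
  ring

theorem summable_logDerivTerm (hp : 3 ≤ p) (i : ℕ) : Summable (logDerivTerm p i) :=
  Summable.of_norm_bounded (summable_natCast_add_mul_pow i) (norm_logDerivTerm_le hp i)

/-- The identity i·C(m+i, i) = (m+i)·C(m+i-1, i-1) cancels the denominator m + i of the logarithm.
-/
theorem natCast_mul_logDerivTerm {i : ℕ} (hi : 1 ≤ i) (m : ℕ) :
    (i : ℚ_[p]) * logDerivTerm p i m =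
      ((m + i - 1).choose (i - 1) : ℚ_[p]) *
        ((-1) ^ (m + i + 1) * invPowerSum p (m + i) * bernoulliFactor p m) := by
  obtain ⟨k, rfl⟩ : ∃ k, i = k + 1 := ⟨i - 1, by omega⟩
  have h := Nat.add_one_mul_choose_eq (m + k) k
  have h2 : ((m + (k + 1) : ℕ) : ℚ_[p]) * ((m + k).choose k : ℚ_[p]) =
      ((m + (k + 1)).choose (k + 1) : ℚ_[p]) * ((k + 1 : ℕ) : ℚ_[p]) := by
    rw [← Nat.cast_mul, ← Nat.cast_mul]
    exact congrArg _ h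
  have h3 : ((m + (k + 1) : ℕ) : ℚ_[p]) ≠ 0 := Nat.cast_ne_zero.2 (by omega)
  rw [logDerivTerm, logProdCoeff, show m + (k + 1) - 1 = m + k by omega, Nat.add_sub_cancel]
  field_simp
  linear_combination (-(invPowerSum p (m + (k + 1))) * bernoulliFactor p m) * h2

theorem norm_natCast_mul_logDerivTerm_le {i : ℕ} (hi : 1 ≤ i) (m : ℕ) :
    ‖(i : ℚ_[p]) * logDerivTerm p i m‖ ≤ ‖bernoulliFactor p m‖ := by
  rw [natCast_mul_logDerivTerm hi]
  refine (norm_natCast_mul_le _ _).trans ?_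
  rw [norm_mul, norm_mul, norm_pow, norm_neg, norm_one, one_pow, one_mul]
  exact mul_le_of_le_one_left (norm_nonneg _) (norm_invPowerSum_le_one _)

/-- Only m = 0 contributes a factor 1/p; all terms with m ≥ 1 are integral. -/
theorem natCast_mul_coeff_logDerivSeries (hp : 3 ≤ p) {i : ℕ} (hi : 1 ≤ i) :
    ∃ e : ℚ_[p], ‖e‖ ≤ 1 ∧ (i : ℚ_[p]) * coeff i (logDerivSeries p) =
      (-1) ^ (i + 1) * invPowerSum p i * (p : ℚ_[p])⁻¹ + e := by
  refine ⟨∑' m, (i : ℚ_[p]) * logDerivTerm p i (m + 1), ?_, ?_⟩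
  · refine IsUltrametricDist.norm_tsum_le_of_forall_le_of_nonneg zero_le_one fun m => ?_
    exact (norm_natCast_mul_logDerivTerm_le hi _).trans (norm_bernoulliFactor_le_one hp (by omega))
  · rw [logDerivSeries, coeff_mk, ← tsum_mul_left,
      ((summable_logDerivTerm hp i).mul_left _).tsum_eq_zero_add, natCast_mul_logDerivTerm hi,
      bernoulliFactor_zero]
    simp

/-- Multiplying by `i` is useless for i = 0. For m ≥ 3 the denominator costs at most m ≤ 3^{m-2} ≤
p^{m-2}, which the bound p^{2-m} on the Bernoulli factor compensates. -/
theorem norm_coeff_zero_logDerivSeries_le (hp : 3 ≤ p) : ‖coeff 0 (logDerivSeries p)‖ ≤ 1 := by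
  have hp0 := natCast_pos p
  rw [logDerivSeries, coeff_mk]
  refine IsUltrametricDist.norm_tsum_le_of_forall_le_of_nonneg zero_le_one fun m => ?_
  rcases lt_or_ge m 3 with hm | hm
  · rw [logDerivTerm, Nat.choose_zero_right, Nat.cast_one, mul_one, add_zero, norm_mul]
    interval_cases m
    -- The term m = 0 is zero because of the convention 0⁻¹ = 0 in `logProdCoeff p 0`.
    · simp [logProdCoeff]
    · exact mul_le_one₀ ((norm_logProdCoeff_le 1).trans (by simp)) (norm_nonneg _)
        (norm_bernoulliFactor_le_one hp le_rfl)
    · refine mul_le_one₀ ?_ (norm_nonneg _) (norm_bernoulliFactor_le_one hp (by norm_num))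
      rw [logProdCoeff, norm_mul, norm_mul, norm_pow, norm_neg, norm_one, one_pow, one_mul,
        Nat.cast_ofNat, norm_two_inv hp, mul_one]
      exact norm_invPowerSum_le_one 2
  · refine (norm_logDerivTerm_le hp 0 m).trans ?_
    have h1 : m ≤ p ^ (m - 2) := by
      refine le_trans ?_ (Nat.pow_le_pow_left hp _)
      induction m, hm using Nat.le_induction with
      | base => norm_num
      | succ m hm ih =>
        rw [show m + 1 - 2 = (m - 2) + 1 by omega, pow_succ]
        omega
    have h2 : (m : ℝ) ≤ (p : ℝ) ^ (m - 2) := by exact_mod_cast h1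
    calc ((m + 0 : ℕ) : ℝ) * ((p : ℝ) ^ 2 * ((p : ℝ)⁻¹) ^ m)
        ≤ (p : ℝ) ^ (m - 2) * ((p : ℝ) ^ 2 * ((p : ℝ)⁻¹) ^ m) := by
          rw [add_zero]; gcongr
      _ = 1 := by
          rw [← mul_assoc, ← pow_add, Nat.sub_add_cancel (by omega), ← mul_pow,
            mul_inv_cancel₀ hp0.ne', one_pow]

theorem hasGammaCoeffs_logDerivSeries (hp : 3 ≤ p) {δ : ℚ_[p]} (hδ : ‖δ‖ ≤ 1) :
    HasGammaCoeffs (logDerivSeries p + C δ) := by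
  have hp0 := natCast_pos p
  have hc : ∀ i, i ≠ 0 → coeff i (logDerivSeries p + C δ) = coeff i (logDerivSeries p) := by
    intro i hi
    rw [map_add, coeff_C, if_neg hi, add_zero]
  have hn : ∀ i, ‖(-1) ^ (i + 1) * invPowerSum p i * (p : ℚ_[p])⁻¹‖ = ‖invPowerSum p i‖ * p := by
    intro i
    simp
  refine ⟨?_, fun i hi => ?_, fun i hi0 hi => ?_⟩
  · rw [map_add, coeff_C, if_pos rfl]
    exact (IsUltrametricDist.norm_add_le_max _ _).trans
      (max_le (norm_coeff_zero_logDerivSeries_le hp) hδ)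
  · have hi0 : i ≠ 0 := by rintro rfl; simp at hi
    obtain ⟨e, he, heq⟩ := natCast_mul_coeff_logDerivSeries hp (Nat.one_le_iff_ne_zero.2 hi0)
    rw [hc i hi0, heq]
    refine (IsUltrametricDist.norm_add_le_max _ _).trans (max_le ?_ he)
    rw [hn, ← le_div_iff₀ hp0, one_div]
    exact norm_invPowerSum_of_not_dvd hp hi
  · obtain ⟨e, he, heq⟩ := natCast_mul_coeff_logDerivSeries hp (Nat.one_le_iff_ne_zero.2 hi0)
    have h1 : ‖(-1) ^ (i + 1) * invPowerSum p i * (p : ℚ_[p])⁻¹‖ = p := by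
      rw [hn, norm_invPowerSum_of_dvd hp hi, one_mul]
    have h2 : ‖e‖ < ‖(-1) ^ (i + 1) * invPowerSum p i * (p : ℚ_[p])⁻¹‖ := by
      rw [h1]; exact he.trans_lt (one_lt_natCast p)
    rw [hc i hi0, heq, IsUltrametricDist.norm_add_eq_max_of_norm_ne_norm h2.ne',
      max_eq_left h2.le, h1]

/-- The functional equation of the logarithmic derivative. -/
theorem expandAt_logDerivSeries (hp : 3 ≤ p) :
    expandAt (logDerivSeries p) (p : ℚ_[p]) = logDerivSeries p +
      PowerSeries.mk fun k => ((k + 1 : ℕ) : ℚ_[p]) * logProdCoeff p (k + 1) := by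
  ext j
  let F : ℕ × ℕ → ℚ_[p] := fun nm =>
    ((nm.1 + j).choose j : ℚ_[p]) * logDerivTerm p (nm.1 + j) nm.2 * (p : ℚ_[p]) ^ nm.1
  have hF : Summable F := by
    have h1 := (summable_natCast_add_mul_pow (p := p) 1).mul_of_nonneg
      (summable_natCast_add_mul_pow (p := p) 1) (fun _ => by positivity) (fun _ => by positivity)
    refine Summable.of_norm_bounded (h1.mul_left (j + 1 : ℝ)) ?_
    rintro ⟨n, m⟩
    simp only [F]
    rw [mul_assoc]
    refine (norm_natCast_mul_le _ _).trans ?_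
    rw [norm_mul, norm_pow, Padic.norm_p]
    have h2 : (((m + (n + j) : ℕ)) : ℝ) ≤ (j + 1) * ((n + 1 : ℕ) : ℝ) * ((m + 1 : ℕ) : ℝ) := by
      have : m + (n + j) ≤ (j + 1) * (n + 1) * (m + 1) := by
        nlinarith [Nat.zero_le (j * n * m), Nat.zero_le (j * n), Nat.zero_le (n * m),
          Nat.zero_le (j * m)]
      exact_mod_cast this
    have h3 : (1 : ℝ) ≤ (p : ℝ) ^ 2 := one_le_pow₀ (one_lt_natCast p).le
    calc ‖logDerivTerm p (n + j) m‖ * ((p : ℝ)⁻¹) ^ n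
        ≤ (((m + (n + j) : ℕ) : ℝ) * ((p : ℝ) ^ 2 * ((p : ℝ)⁻¹) ^ m)) * ((p : ℝ)⁻¹) ^ n := by
          gcongr; exact norm_logDerivTerm_le hp _ _
      _ ≤ (((j + 1) * ((n + 1 : ℕ) : ℝ) * ((m + 1 : ℕ) : ℝ)) * ((p : ℝ) ^ 2 * ((p : ℝ)⁻¹) ^ m)) *
          ((p : ℝ) ^ 2 * ((p : ℝ)⁻¹) ^ n) := by
          gcongr
          exact le_mul_of_one_le_left (by positivity) h3
      _ = _ := by ring
  have e1 : coeff j (expandAt (logDerivSeries p) (p : ℚ_[p])) = ∑' nm, F nm := by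
    rw [hF.tsum_prod, expandAt, coeff_mk]
    refine tsum_congr fun n => ?_
    rw [logDerivSeries, coeff_mk, Algebra.algebraMap_self, RingHom.id_apply, ← tsum_mul_left,
      ← tsum_mul_right]
  -- Grouping by k = n + m leaves ∑_{i≤k} C(k, i) B_i. The part i < k is 1 for k = 1 and 0
  -- otherwise, giving f'; the term i = k restores the original series.
  have e2 : ∀ k, ∑ nm ∈ Finset.HasAntidiagonal.antidiagonal k, F nm =
      logDerivTerm p j k + if k = 1 then ((j + 1 : ℕ) : ℚ_[p]) * logProdCoeff p (j + 1) else 0 := by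
    intro k
    have h1 : ∀ i ∈ Finset.range (k + 1), F (k - i, i) =
        logProdCoeff p (k + j) * (k + j).choose j * ((p : ℚ_[p]) ^ k / p) *
          (((k.choose i : ℚ) * bernoulli i : ℚ) : ℚ_[p]) := by
      intro i hi
      rw [Finset.mem_range] at hi
      simp only [F, logDerivTerm, bernoulliFactor]
      have h2 : (k + j).choose (k - i + j) * (k - i + j).choose j =
          (k + j).choose j * k.choose i := by
        rw [Nat.choose_mul (by omega), Nat.add_sub_cancel, Nat.add_sub_cancel,
          Nat.choose_symm (by omega)]
      have h3 : ((k + j).choose (k - i + j) : ℚ_[p]) * ((k - i + j).choose j : ℚ_[p]) =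
          ((k + j).choose j : ℚ_[p]) * (k.choose i : ℚ_[p]) := by exact_mod_cast h2
      have h4 : (p : ℚ_[p]) ^ k = (p : ℚ_[p]) ^ i * (p : ℚ_[p]) ^ (k - i) := by
        rw [← pow_add]; congr 1; omega
      rw [show i + (k - i + j) = k + j by omega, h4]
      push_cast
      linear_combination (logProdCoeff p (k + j) * ((bernoulli i : ℚ) : ℚ_[p]) *
        ((p : ℚ_[p]) ^ i / p) * (p : ℚ_[p]) ^ (k - i)) * h3
    rw [← Finset.Nat.sum_antidiagonal_swap, Finset.Nat.sum_antidiagonal_eq_sum_range_succ_mk]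
    simp only [Prod.swap_prod_mk]
    rw [Finset.sum_congr rfl h1, ← Finset.mul_sum, ← Rat.cast_sum, Finset.sum_range_succ,
      sum_bernoulli, Nat.choose_self, Nat.cast_one, one_mul]
    push_cast
    rw [mul_add, add_comm, logDerivTerm, bernoulliFactor]
    congr 1
    · ring
    · split_ifs with hk
      · subst hk
        rw [pow_one, div_self (by exact_mod_cast hpf.out.ne_zero), add_comm 1 j]
        simp [mul_comm]
      · simp
  rw [e1, tsum_antidiagonal hF, map_add, logDerivSeries, coeff_mk, coeff_mk]
  simp only [e2]
  have h5 : HasSum (fun k => if k = 1 then ((j + 1 : ℕ) : ℚ_[p]) * logProdCoeff p (j + 1) else 0)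
      (((j + 1 : ℕ) : ℚ_[p]) * logProdCoeff p (j + 1)) := hasSum_ite_eq 1 _
  exact ((summable_logDerivTerm hp j).hasSum.add h5).tsum_eq

end Arithmetic

/-! ## The functional equation of the solution -/

section Translation

variable {p : ℕ} [hpf : Fact p.Prime]

theorem expandAt_add {r : ℝ} {f g : ℚ_[p]⟦X⟧} (hf : IsAnalyticOnDisc f r)
    (hg : IsAnalyticOnDisc g r) {t : ℚ_[p]} (ht : ‖t‖ < r) :
    expandAt (f + g) t = expandAt f t + expandAt g t := by
  ext k
  rw [map_add]
  refine (hasSum_coeff_expandAt (hf.add hg) ht k).unique ?_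
  refine ((hasSum_coeff_expandAt hf ht k).add (hasSum_coeff_expandAt hg ht k)).congr_fun ?_
  intro n
  rw [map_add, map_add]; ring

theorem expandAt_C (c t : ℚ_[p]) : expandAt (C c) t = C c := by
  ext k
  rw [expandAt, coeff_mk, tsum_eq_single 0]
  · by_cases hk : k = 0 <;> simp [hk, coeff_C]
  · intro n hn
    rw [coeff_C, if_neg (by omega)]
    simp

theorem isAnalyticOnDisc_C (c : ℚ_[p]) (r : ℝ) : IsAnalyticOnDisc (C c) r := by
  have := isAnalyticOnDisc_polynomial (Polynomial.C c) r
  rwa [Polynomial.coe_C] at this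

theorem evalAt_C_mul (c : ℚ_[p]) (f : ℚ_[p]⟦X⟧) (x : ℚ_[p]) :
    evalAt (C c * f) x = c * evalAt f x := by
  rw [evalAt, evalAt, ← tsum_mul_left]
  refine tsum_congr fun n => ?_
  rw [PowerSeries.coeff_C_mul, mul_assoc]

/-- If `g(T + t) = g(T) + U'(T) / U(T)`, then the solution `Y` of `Y' = g Y` satisfies
`Y(T + t) = κ U(T) Y(T)`, where `κ` is a constant. -/
theorem evalAt_add_of_expandAt_eq {g q U : ℚ_[p]⟦X⟧} {t : ℚ_[p]} {r : ℝ}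
    (hg : IsAnalyticOnDisc g r) (hU : IsAnalyticOnDisc U r) (hY : IsAnalyticOnDisc (odeSol g) r)
    (ht : ‖t‖ < r) (hgt : expandAt g t = g + q) (hUq : derivative ℚ_[p] U = q * U)
    {x : ℚ_[p]} (hx : ‖x‖ < r) :
    constantCoeff U * evalAt (odeSol g) (t + x) =
      evalAt (odeSol g) t * (evalAt (odeSol g) x * evalAt U x) := by
  have hr : 0 < r := (norm_nonneg x).trans_lt hx
  have hc : constantCoeff (expandAt (odeSol g) t) = evalAt (odeSol g) t := by
    have := evalAt_expandAt hY ht (x := 0) (by simpa using hr)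
    rwa [evalAt_zero_right, add_zero] at this
  have h1 : derivative ℚ_[p] (expandAt (odeSol g) t) = (g + q) * expandAt (odeSol g) t := by
    rw [derivative_expandAt, derivative_odeSol, expandAt_mul hg hY ht, hgt]
  have h2 : derivative ℚ_[p] (odeSol g * U) = (g + q) * (odeSol g * U) := by
    rw [Derivation.leibniz, derivative_odeSol, hUq]
    simp only [smul_eq_mul]; ring
  -- Y(T + t) and Y·U solve the same equation, so they are multiples of one series by their constant
  -- terms Y(t) and U(0).
  have h3 := eq_C_mul_odeSol h1
  have h4 := eq_C_mul_odeSol h2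
  rw [hc] at h3
  rw [map_mul, constantCoeff_odeSol, one_mul] at h4
  have h5 : C (constantCoeff U) * expandAt (odeSol g) t =
      C (evalAt (odeSol g) t) * (odeSol g * U) := by
    rw [h3, h4]; ring
  have h6 := congrArg (fun f => evalAt f x) h5
  simp only [evalAt_C_mul] at h6
  rwa [evalAt_expandAt hY ht hx, evalAt_mul hY hU hx] at h6

variable (p) in
/-- The polynomial `-(T + 1) ⋯ (T + p - 1)`. -/
def shiftPoly : Polynomial ℚ_[p] := -∏ j ∈ Finset.Ico 1 p, (Polynomial.X + Polynomial.C (j : ℚ_[p]))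

theorem mul_mk_inv {a : ℚ_[p]} (ha : a ≠ 0) :
    (X + C a) * PowerSeries.mk (fun k => (-1) ^ k * a⁻¹ ^ (k + 1)) = 1 := by
  ext k
  rw [add_mul, map_add, PowerSeries.coeff_C_mul, coeff_mk, PowerSeries.coeff_one]
  cases k with
  | zero =>
    rw [PowerSeries.coeff_zero_X_mul]
    simp [ha]
  | succ k =>
    rw [PowerSeries.coeff_succ_X_mul, coeff_mk, if_neg (Nat.succ_ne_zero k), pow_succ a⁻¹ (k + 1)]
    have h : a * a⁻¹ = 1 := mul_inv_cancel₀ ha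
    linear_combination ((-1) ^ (k + 1) * a⁻¹ ^ (k + 1)) * h

theorem derivative_prod_X_add_C {S : Finset ℕ} (hS : 0 ∉ S) :
    derivative ℚ_[p] (∏ j ∈ S, (X + C (j : ℚ_[p]))) =
      (∑ j ∈ S, PowerSeries.mk fun k => (-1) ^ k * ((j : ℚ_[p])⁻¹) ^ (k + 1)) *
        ∏ j ∈ S, (X + C (j : ℚ_[p])) := by
  induction S using Finset.induction_on with
  | empty => simp
  | insert a S ha ih =>
    rw [Finset.mem_insert, not_or] at hS
    have h0 : (a : ℚ_[p]) ≠ 0 := Nat.cast_ne_zero.2 (Ne.symm hS.1)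
    have h1 := mul_mk_inv h0
    rw [Finset.prod_insert ha, Finset.sum_insert ha, Derivation.leibniz, ih hS.2]
    simp only [map_add, PowerSeries.derivative_X, PowerSeries.derivative_C, smul_eq_mul, add_zero,
      mul_one]
    linear_combination (-∏ j ∈ S, (X + C (j : ℚ_[p]))) * h1

theorem coe_shiftPoly : (shiftPoly p : ℚ_[p]⟦X⟧) = -∏ j ∈ Finset.Ico 1 p, (X + C (j : ℚ_[p])) := by
  rw [shiftPoly, ← Polynomial.coeToPowerSeries.ringHom_apply, map_neg, map_prod]
  congr 1
  refine Finset.prod_congr rfl fun j _ => ?_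
  rw [Polynomial.coeToPowerSeries.ringHom_apply, Polynomial.coe_add, Polynomial.coe_X,
    Polynomial.coe_C]

theorem derivative_shiftPoly :
    derivative ℚ_[p] (shiftPoly p : ℚ_[p]⟦X⟧) =
      (PowerSeries.mk fun k => ((k + 1 : ℕ) : ℚ_[p]) * logProdCoeff p (k + 1)) *
        (shiftPoly p : ℚ_[p]⟦X⟧) := by
  have h1 : (PowerSeries.mk fun k => ((k + 1 : ℕ) : ℚ_[p]) * logProdCoeff p (k + 1)) =
      ∑ j ∈ Finset.Ico 1 p, PowerSeries.mk fun k => (-1) ^ k * ((j : ℚ_[p])⁻¹) ^ (k + 1) := by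
    ext k
    have h2 : ((k + 1 : ℕ) : ℚ_[p]) ≠ 0 := Nat.cast_ne_zero.2 (Nat.succ_ne_zero k)
    rw [map_sum]
    simp only [coeff_mk]
    rw [← Finset.mul_sum, logProdCoeff, invPowerSum, pow_succ, pow_succ]
    field_simp
  rw [h1, coe_shiftPoly, map_neg, derivative_prod_X_add_C (by simp), mul_neg]

/-- The constant term is -(p - 1)!, so this is Wilson's theorem. -/
theorem norm_constantCoeff_shiftPoly_sub_one :
    ‖constantCoeff (shiftPoly p : ℚ_[p]⟦X⟧) - 1‖ < 1 := by
  have h1 : constantCoeff (shiftPoly p : ℚ_[p]⟦X⟧) - 1 = -(((p - 1).factorial + 1 : ℕ) : ℚ_[p]) := by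
    rw [coe_shiftPoly, map_neg, map_prod]
    have : ∏ j ∈ Finset.Ico 1 p, constantCoeff (X + C (j : ℚ_[p])) =
        ((p - 1).factorial : ℚ_[p]) := by
      rw [← Finset.prod_Ico_id_eq_factorial, Nat.sub_add_cancel hpf.out.one_le]
      simp
    rw [this]
    push_cast; ring
  rw [h1, norm_neg, Padic.norm_natCast_lt_one_iff, ← ZMod.natCast_eq_zero_iff]
  push_cast
  rw [ZMod.wilsons_lemma]
  ring

theorem norm_eq_one_of_sub_one {x : ℚ_[p]} (h : ‖x - 1‖ < 1) : ‖x‖ = 1 := by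
  have h1 : ‖x - 1‖ ≠ ‖(1 : ℚ_[p])‖ := by rw [norm_one]; exact h.ne
  have := IsUltrametricDist.norm_add_eq_max_of_norm_ne_norm h1
  rwa [sub_add_cancel, norm_one, max_eq_right h.le] at this

end Translation

/-! ## The exponential -/

section Exponential

variable {p : ℕ} [hpf : Fact p.Prime]

theorem omega_pow_pred_le_norm_factorial {k : ℕ} (hk : 1 ≤ k) :
    omega p ^ (k - 1) ≤ ‖((k.factorial : ℕ) : ℚ_[p])‖ := by
  rw [Padic.norm_eq_zpow_neg_valuation (Nat.cast_ne_zero.2 (Nat.factorial_ne_zero _)),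
    Padic.valuation_natCast, zpow_neg, zpow_natCast, ← inv_pow, ← omega_pow, ← pow_mul]
  refine pow_le_pow_of_le_one (omega_pos p).le (omega_lt_one p).le ?_
  have := sub_one_mul_padicValNat_factorial_lt_of_ne_zero p (n := k) (by omega)
  omega

/-- In exponents this is 1/(p - 1) + 1/p < 1, true for p ≥ 3. Hence pℤ_p lies inside the disc where
Y converges. -/
theorem inv_lt_omega_mul_breakRadius (hp : 3 ≤ p) : (p : ℝ)⁻¹ < omega p * breakRadius p 0 := by
  have hw := omega_pos p
  have hb := breakRadius_pos p 0
  have hp0 := natCast_pos p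
  refine lt_of_pow_lt_pow_left₀ ((p - 1) * p) (by positivity) ?_
  rw [mul_pow, pow_mul (omega p), omega_pow, mul_comm (p - 1) p, pow_mul (breakRadius p 0),
    breakRadius_zero_pow, ← pow_add]
  refine pow_lt_pow_right_of_lt_one₀ (by positivity) inv_natCast_lt_one ?_
  obtain ⟨q, rfl⟩ : ∃ q, p = q + 1 := ⟨p - 1, by omega⟩
  simp only [Nat.add_sub_cancel]
  nlinarith

theorem inv_lt_omega (hp : 3 ≤ p) : (p : ℝ)⁻¹ < omega p :=
  (inv_lt_omega_mul_breakRadius hp).trans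
    (mul_lt_of_lt_one_right (omega_pos p) (lt_one_of_le_breakRadius le_rfl))

theorem odeSeq_C (δ : ℚ_[p]) (k : ℕ) :
    odeSeq (fun i => coeff i (C δ : ℚ_[p]⟦X⟧)) k = δ ^ k := by
  induction k with
  | zero => simp [odeSeq]
  | succ k ih =>
    rw [odeSeq_succ, Finset.sum_eq_single 0]
    · simp [ih, pow_succ']
    · intro i _ hi
      simp [coeff_C, hi]
    · simp

theorem isAnalyticOnDisc_odeSol_C {δ : ℚ_[p]} (hδ : ‖δ‖ ≤ 1) :
    IsAnalyticOnDisc (odeSol (C δ)) (omega p) := by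
  have := isAnalyticOnDisc_odeSol (p := p) (g := (C δ : ℚ_[p]⟦X⟧)) one_pos fun i => ?_
  · rwa [div_one] at this
  · rw [one_pow, coeff_C]
    split_ifs
    · exact hδ
    · simp

theorem norm_pow_sub_pow_le (x y : ℤ_[p]) (k : ℕ) : ‖x ^ k - y ^ k‖ ≤ ‖x - y‖ := by
  obtain ⟨c, hc⟩ := sub_dvd_pow_sub_pow x y k
  rw [hc, norm_mul]
  exact mul_le_of_le_one_right (norm_nonneg _) (PadicInt.norm_le_one c)

theorem norm_pow_div_factorial_le (hp : 3 ≤ p) (k : ℕ) :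
    ‖(p : ℚ_[p]) ^ (k + 1) / ((k + 2).factorial : ℚ_[p])‖ ≤ (p : ℝ)⁻¹ := by
  apply norm_le_inv_of_lt_one
  have hp0 := natCast_pos p
  have hw := omega_pos p
  have h1 := omega_pow_pred_le_norm_factorial (p := p) (k := k + 2) (by omega)
  rw [show k + 2 - 1 = k + 1 by omega] at h1
  rw [norm_div, norm_pow, Padic.norm_p, div_lt_one ((pow_pos hw _).trans_le h1)]
  exact lt_of_lt_of_le (pow_lt_pow_left₀ (inv_lt_omega hp) (by positivity) (Nat.succ_ne_zero k)) h1

/-- Every element of `1 + pℤ_p` is of the form `exp (p δ)` with `δ` in `ℤ_p`. -/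
theorem exists_evalAt_odeSol_C_eq (hp : 3 ≤ p) {w : ℚ_[p]} (hw : ‖w - 1‖ < 1) :
    ∃ δ : ℚ_[p], ‖δ‖ ≤ 1 ∧ evalAt (odeSol (C δ)) (p : ℚ_[p]) = w := by
  have hp0 := natCast_pos p
  have hpne : (p : ℚ_[p]) ≠ 0 := by exact_mod_cast hpf.out.ne_zero
  have hnp : ‖(p : ℚ_[p])‖ < omega p := by rw [Padic.norm_p]; exact inv_lt_omega hp
  let a : ℕ → ℚ_[p] := fun k => (p : ℚ_[p]) ^ (k + 1) / ((k + 2).factorial : ℚ_[p])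
  have ha : ∀ k, ‖a k‖ ≤ (p : ℝ)⁻¹ := norm_pow_div_factorial_le hp
  have hterm : ∀ (δ : ℚ_[p]) (n : ℕ), coeff n (odeSol (C δ)) * (p : ℚ_[p]) ^ n =
      δ ^ n * (p : ℚ_[p]) ^ n / (n.factorial : ℚ_[p]) := by
    intro δ n
    rw [coeff_odeSol, odeSeq_C]; ring
  have hsum : ∀ δ : ℚ_[p], ‖δ‖ ≤ 1 → HasSum (fun k => δ ^ (k + 2) * a k)
      ((evalAt (odeSol (C δ)) (p : ℚ_[p]) - 1) / p - δ) := by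
    intro δ hδ
    have h1 := (isAnalyticOnDisc_odeSol_C hδ).hasSum hnp
    rw [← hasSum_nat_add_iff' 2] at h1
    have h2 := h1.div_const (p : ℚ_[p])
    simp only [hterm, Finset.sum_range_succ, Finset.sum_range_zero] at h2
    have e : (evalAt (odeSol (C δ)) (p : ℚ_[p]) - (0 + δ ^ 0 * (p : ℚ_[p]) ^ 0 /
        ((Nat.factorial 0 : ℕ) : ℚ_[p]) + δ ^ 1 * (p : ℚ_[p]) ^ 1 /
        ((Nat.factorial 1 : ℕ) : ℚ_[p]))) / p =
        (evalAt (odeSol (C δ)) (p : ℚ_[p]) - 1) / p - δ := by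
      simp only [pow_zero, pow_one, Nat.factorial, Nat.cast_one, div_one]
      field_simp
      ring
    rw [e] at h2
    refine h2.congr_fun fun k => ?_
    simp only [a]
    field_simp
    ring
  -- Since exp(pδ) = 1 + p(δ + ∑ δ^{k+2} a_k), the equation exp(pδ) = w is the fixed point equation
  -- δ = (w - 1)/p - ∑ δ^{k+2} a_k. It is contracting because |a_k| ≤ 1/p.
  let φ : ℤ_[p] → ℚ_[p] := fun δ =>
    (w - 1) / p - ((evalAt (odeSol (C (δ : ℚ_[p]))) (p : ℚ_[p]) - 1) / p - δ)
  have hφ : ∀ δ, ‖φ δ‖ ≤ 1 := by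
    intro δ
    refine (norm_sub_le_max_of_ultrametric _ _).trans (max_le ?_ ?_)
    · rw [norm_div, Padic.norm_p, div_inv_eq_mul, ← le_div_iff₀ hp0, one_div]
      exact norm_le_inv_of_lt_one hw
    · rw [← (hsum δ (PadicInt.norm_le_one δ)).tsum_eq]
      refine IsUltrametricDist.norm_tsum_le_of_forall_le_of_nonneg zero_le_one fun k => ?_
      rw [norm_mul, norm_pow]
      exact mul_le_one₀ (pow_le_one₀ (norm_nonneg _) (PadicInt.norm_le_one δ)) (norm_nonneg _)
        ((ha k).trans inv_natCast_lt_one.le)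
  let ψ : ℤ_[p] → ℤ_[p] := fun δ => ⟨φ δ, hφ δ⟩
  have hcontr : ContractingWith ⟨(p : ℝ)⁻¹, by positivity⟩ ψ := by
    refine ⟨by exact_mod_cast inv_natCast_lt_one (p := p), LipschitzWith.of_dist_le_mul fun x y => ?_⟩
    rw [dist_eq_norm, dist_eq_norm]
    have h1 : ((ψ x - ψ y : ℤ_[p]) : ℚ_[p]) = φ x - φ y := by
      rw [PadicInt.coe_sub]
    have h2 := (hsum y (PadicInt.norm_le_one y)).sub (hsum x (PadicInt.norm_le_one x))
    rw [← PadicInt.padic_norm_e_of_padicInt, h1]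
    have h3 : φ x - φ y = ∑' k, ((y : ℚ_[p]) ^ (k + 2) * a k - (x : ℚ_[p]) ^ (k + 2) * a k) := by
      rw [h2.tsum_eq]; simp only [φ]; ring
    rw [h3]
    refine IsUltrametricDist.norm_tsum_le_of_forall_le_of_nonneg
      (mul_nonneg (inv_nonneg.2 hp0.le) (norm_nonneg _)) fun k => ?_
    rw [← sub_mul, norm_mul, mul_comm]
    refine mul_le_mul (ha k) ?_ (norm_nonneg _) (inv_nonneg.2 hp0.le)
    rw [norm_sub_rev]
    have := norm_pow_sub_pow_le x y (k + 2)
    rwa [← PadicInt.padic_norm_e_of_padicInt, PadicInt.coe_sub, PadicInt.coe_pow,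
      PadicInt.coe_pow] at this
  obtain ⟨δ, hδ, -⟩ := hcontr.exists_fixedPoint 0 (edist_ne_top _ _)
  refine ⟨δ, PadicInt.norm_le_one δ, ?_⟩
  have h1 : φ δ = δ := congrArg Subtype.val hδ
  simp only [φ] at h1
  have h2 : (w - 1) / p = (evalAt (odeSol (C (δ : ℚ_[p]))) (p : ℚ_[p]) - 1) / p := by
    linear_combination h1
  rw [div_left_inj' hpne] at h2
  linear_combination -h2

end Exponential

/-! ## The Taylor expansion of the Gamma function -/

section Taylor

variable {p : ℕ} [hpf : Fact p.Prime]

theorem HasGammaCoeffs.isAnalyticOnDisc_odeSol {g : ℚ_[p]⟦X⟧} (hg : HasGammaCoeffs g)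
    (hp : 3 ≤ p) : IsAnalyticOnDisc (odeSol g) (omega p * breakRadius p 0) := by
  have hb := breakRadius_pos p 0
  have := MoritaGamma.isAnalyticOnDisc_odeSol (p := p) (g := g) (inv_pos.2 hb) fun i => ?_
  · rwa [div_inv_eq_mul] at this
  · rw [inv_pow, ← one_div, le_div_iff₀ (by positivity)]
    exact hg.mul_pow_le_one hp hb.le (breakRadius_zero_pow p).le i

theorem HasGammaCoeffs.norm_evalAt_odeSol_sub_one {g : ℚ_[p]⟦X⟧} (hg : HasGammaCoeffs g)
    (hp : 3 ≤ p) : ‖evalAt (odeSol g) (p : ℚ_[p]) - 1‖ < 1 := by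
  have hb := breakRadius_pos p 0
  have hw := omega_pos p
  have hp0 := natCast_pos p
  have hlt := inv_lt_omega_mul_breakRadius hp
  have hnp : ‖(p : ℚ_[p])‖ < omega p * breakRadius p 0 := by rwa [Padic.norm_p]
  have h1 := (hg.isAnalyticOnDisc_odeSol hp).hasSum hnp
  rw [← hasSum_nat_add_iff' 1] at h1
  have h0 : ∑ i ∈ Finset.range 1, coeff i (odeSol g) * (p : ℚ_[p]) ^ i = 1 := by simp [odeSeq]
  rw [h0] at h1
  rw [← h1.tsum_eq]
  refine lt_of_le_of_lt ?_ (inv_natCast_lt_one (p := p))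
  refine IsUltrametricDist.norm_tsum_le_of_forall_le_of_nonneg (by positivity) fun k => ?_
  -- Norms are discrete, so termwise bounds below 1 give the uniform bound 1/p.
  apply norm_le_inv_of_lt_one
  have h2 : ‖odeSeq (fun i => coeff i g) (k + 1)‖ ≤ (breakRadius p 0)⁻¹ ^ (k + 1) := by
    refine norm_odeSeq_le (inv_pos.2 hb).le (fun i => ?_) _
    rw [inv_pow, ← one_div, le_div_iff₀ (by positivity)]
    exact hg.mul_pow_le_one hp hb.le (breakRadius_zero_pow p).le i
  have h3 := omega_pow_pred_le_norm_factorial (p := p) (k := k + 1) (by omega)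
  rw [Nat.add_sub_cancel] at h3
  have h4 : 0 < ‖(((k + 1).factorial : ℕ) : ℚ_[p])‖ := (pow_pos hw _).trans_le h3
  rw [coeff_odeSol, norm_mul, norm_div, norm_pow, Padic.norm_p, div_mul_eq_mul_div,
    div_lt_one h4]
  refine lt_of_lt_of_le ?_ h3
  calc _ ≤ (breakRadius p 0)⁻¹ ^ (k + 1) * ((p : ℝ)⁻¹) ^ (k + 1) := by gcongr
    _ = ((breakRadius p 0)⁻¹ * (p : ℝ)⁻¹) ^ (k + 1) := by rw [mul_pow]
    _ < omega p ^ (k + 1) := by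
        refine pow_lt_pow_left₀ ?_ (by positivity) (Nat.succ_ne_zero k)
        rw [inv_mul_lt_iff₀ hb, mul_comm]
        exact hlt
    _ ≤ omega p ^ k := pow_le_pow_of_le_one hw.le (omega_lt_one p).le (Nat.le_succ k)

/-- The solution, suitably normalized, satisfies the functional equation of the Gamma function. -/
theorem exists_odeSol_functional_equation (hp : 3 ≤ p) :
    ∃ g : ℚ_[p]⟦X⟧, HasGammaCoeffs g ∧ ∀ x : ℚ_[p], ‖x‖ ≤ (p : ℝ)⁻¹ →
      evalAt (odeSol g) (p + x) = evalAt (odeSol g) x * (shiftPoly p).eval x := by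
  have hw := omega_pos p
  have hlt := inv_lt_omega_mul_breakRadius hp
  have hnp : ‖(p : ℚ_[p])‖ < omega p * breakRadius p 0 := by rwa [Padic.norm_p]
  have hb1 : breakRadius p 0 < 1 := lt_one_of_le_breakRadius le_rfl
  have hr1 : omega p * breakRadius p 0 < 1 :=
    mul_lt_one_of_nonneg_of_lt_one_left hw.le (omega_lt_one p) hb1.le
  have hg0 : HasGammaCoeffs (logDerivSeries p) := by
    have := hasGammaCoeffs_logDerivSeries hp (δ := 0) (by simp)
    rwa [map_zero, add_zero] at this
  set u : ℚ_[p] := constantCoeff (shiftPoly p : ℚ_[p]⟦X⟧) with hu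
  set y : ℚ_[p] := evalAt (odeSol (logDerivSeries p)) (p : ℚ_[p]) with hy
  have hu1 : ‖u - 1‖ < 1 := norm_constantCoeff_shiftPoly_sub_one
  have hy1 : ‖y - 1‖ < 1 := hg0.norm_evalAt_odeSol_sub_one hp
  have hun := norm_eq_one_of_sub_one hu1
  have hyn := norm_eq_one_of_sub_one hy1
  have hu0 : u ≠ 0 := norm_ne_zero_iff.1 (by rw [hun]; exact one_ne_zero)
  have hy0 : y ≠ 0 := norm_ne_zero_iff.1 (by rw [hyn]; exact one_ne_zero)
  -- Adding δ to the logarithmic derivative multiplies Y(p) by exp(pδ); this choice makes Y(p) equal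
  -- to U(0).
  obtain ⟨δ, hδ, hδw⟩ := exists_evalAt_odeSol_C_eq hp (w := u / y) (by
    rw [show u / y - 1 = ((u - 1) - (y - 1)) / y by field_simp; ring, norm_div, hyn, div_one]
    exact (norm_sub_le_max_of_ultrametric _ _).trans_lt (max_lt hu1 hy1))
  have hg := hasGammaCoeffs_logDerivSeries hp hδ
  refine ⟨_, hg, fun x hx => ?_⟩
  have hx' : ‖x‖ < omega p * breakRadius p 0 := hx.trans_lt hlt
  have hgan := hg.isAnalyticOnDisc.mono hr1.le
  have hg0an := hg0.isAnalyticOnDisc.mono hr1.le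
  have hshift : expandAt (logDerivSeries p + C δ) (p : ℚ_[p]) = (logDerivSeries p + C δ) +
      PowerSeries.mk fun k => ((k + 1 : ℕ) : ℚ_[p]) * logProdCoeff p (k + 1) := by
    rw [expandAt_add hg0an (isAnalyticOnDisc_C δ _) hnp, expandAt_C, expandAt_logDerivSeries hp]
    ring
  have hyp : evalAt (odeSol (logDerivSeries p + C δ)) (p : ℚ_[p]) = u := by
    rw [← odeSol_mul_odeSol, evalAt_mul (hg0.isAnalyticOnDisc_odeSol hp)
      ((isAnalyticOnDisc_odeSol_C hδ).mono (mul_le_of_le_one_right hw.le hb1.le)) hnp, hδw, ← hy,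
      mul_div_cancel₀ _ hy0]
  have key := evalAt_add_of_expandAt_eq hgan (isAnalyticOnDisc_polynomial (shiftPoly p) _)
    (hg.isAnalyticOnDisc_odeSol hp) hnp hshift derivative_shiftPoly hx'
  rw [hyp, evalAt_polynomial] at key
  exact mul_left_cancel₀ hu0 key

/-- The step at pm contributes only a sign, whence `r + 1` signs for `r` factors. -/
theorem gammaNat_mul_add (m : ℕ) {r : ℕ} (hr : r < p) :
    gammaNat p (p * m + 1 + r) =
      (-1) ^ (r + 1) * (∏ j ∈ Finset.Ico 1 (r + 1), ((p * m + j : ℕ) : ℤ_[p])) *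
        gammaNat p (p * m) := by
  induction r with
  | zero => rw [add_zero, gammaNat_succ, if_pos (dvd_mul_right p m)]; simp
  | succ r ih =>
    have hnd : ¬ p ∣ p * m + 1 + r := by
      rw [add_assoc, ← Nat.dvd_add_iff_right (dvd_mul_right p m)]
      exact Nat.not_dvd_of_pos_of_lt (by omega) (by omega)
    rw [← add_assoc, gammaNat_succ, if_neg hnd, ih (by omega),
      Finset.prod_Ico_succ_top (show 1 ≤ r + 1 by omega),
      show p * m + 1 + r = p * m + (r + 1) by ring]
    ring

theorem gammaNat_mul_succ (hp : p ≠ 2) (m : ℕ) :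
    ((gammaNat p (p * (m + 1)) : ℤ_[p]) : ℚ_[p]) =
      (gammaNat p (p * m) : ℤ_[p]) * (shiftPoly p).eval (p * m : ℚ_[p]) := by
  have hp1 := hpf.out.one_le
  have h := gammaNat_mul_add (p := p) m (r := p - 1) (by omega)
  rw [show p * m + 1 + (p - 1) = p * (m + 1) by rw [mul_add]; omega, Nat.sub_add_cancel hp1,
    (hpf.out.odd_of_ne_two hp).neg_one_pow] at h
  have hc : ((∏ j ∈ Finset.Ico 1 p, ((p * m + j : ℕ) : ℤ_[p]) : ℤ_[p]) : ℚ_[p]) =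
      ∏ j ∈ Finset.Ico 1 p, (((p * m + j : ℕ) : ℤ_[p]) : ℚ_[p]) :=
    map_prod PadicInt.Coe.ringHom _ _
  rw [h, shiftPoly, Polynomial.eval_neg, Polynomial.eval_prod]
  push_cast at hc ⊢
  rw [hc]
  simp only [Polynomial.eval_add, Polynomial.eval_X, Polynomial.eval_C]
  ring

theorem evalAt_odeSol_eq_gammaNat (hp : p ≠ 2) {g : ℚ_[p]⟦X⟧}
    (h : ∀ x : ℚ_[p], ‖x‖ ≤ (p : ℝ)⁻¹ →
      evalAt (odeSol g) (p + x) = evalAt (odeSol g) x * (shiftPoly p).eval x) (m : ℕ) :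
    evalAt (odeSol g) (p * m : ℚ_[p]) = (gammaNat p (p * m) : ℤ_[p]) := by
  induction m with
  | zero => simp [evalAt_zero_right, gammaNat_zero]
  | succ m ih =>
    have hx : ‖(p * m : ℚ_[p])‖ ≤ (p : ℝ)⁻¹ := by
      rw [norm_mul, Padic.norm_p]
      exact mul_le_of_le_one_right (by positivity) (IsUltrametricDist.norm_natCast_le_one _ m)
    rw [gammaNat_mul_succ hp, ← ih, ← h _ hx]
    congr 1
    push_cast; ring

theorem continuous_evalAt_mul {f : ℚ_[p]⟦X⟧} {r : ℝ} (hf : IsAnalyticOnDisc f r)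
    (hr : (p : ℝ)⁻¹ < r) : Continuous fun z : ℤ_[p] => evalAt f ((p : ℚ_[p]) * (z : ℚ_[p])) := by
  have hs := hf.summable_norm (x := (p : ℚ_[p])) (by rwa [Padic.norm_p])
  refine continuous_tsum (fun n => ?_) hs fun n z => ?_
  · exact continuous_const.mul ((continuous_const.mul continuous_subtype_val).pow n)
  · rw [mul_pow, ← mul_assoc, norm_mul _ ((z : ℚ_[p]) ^ n), norm_pow]
    exact mul_le_of_le_one_right (norm_nonneg _) (pow_le_one₀ (norm_nonneg _) (PadicInt.norm_le_one z))

/-- The expansion at `0` of the Gamma function is the solution of an explicit equation. -/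
theorem exists_isTaylorExpansionAtZero_odeSol (hp : 3 ≤ p) :
    ∃ g : ℚ_[p]⟦X⟧, HasGammaCoeffs g ∧
      IsTaylorExpansionAtZero (moritaGamma p) (odeSol g) := by
  have hp2 : p ≠ 2 := by omega
  have hlt := inv_lt_omega_mul_breakRadius hp
  obtain ⟨g, hg, hfun⟩ := exists_odeSol_functional_equation hp
  have han := hg.isAnalyticOnDisc_odeSol hp
  -- The neighbourhood ‖x‖ < 1 is pℤ_p, so x = pz, and density of ℕ in ℤ_p is applied to z.
  refine ⟨g, hg, 1, one_pos, fun x hx => ?_⟩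
  have heq : (fun z : ℤ_[p] => evalAt (odeSol g) ((p : ℚ_[p]) * (z : ℚ_[p]))) =
      fun z : ℤ_[p] => ((moritaGamma p (p * z) : ℤ_[p]) : ℚ_[p]) := by
    refine PadicInt.denseRange_natCast.equalizer (continuous_evalAt_mul han hlt)
      (continuous_subtype_val.comp
        ((continuous_moritaGamma p hp2).comp (continuous_const.mul continuous_id)))
      (funext fun m => ?_)
    simp only [Function.comp_apply]
    rw [PadicInt.coe_natCast, evalAt_odeSol_eq_gammaNat hp2 hfun, ← moritaGamma_natCast p hp2]
    push_cast
    rfl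
  obtain ⟨z, rfl⟩ := (PadicInt.norm_lt_one_iff_dvd x).1 hx
  have h1 : evalAt (odeSol g) ((p : ℚ_[p]) * (z : ℚ_[p])) =
      ((moritaGamma p (p * z) : ℤ_[p]) : ℚ_[p]) := congrFun heq z
  rw [← h1, PadicInt.coe_mul, PadicInt.coe_natCast]
  refine han.hasSum (lt_of_le_of_lt ?_ hlt)
  rw [norm_mul, Padic.norm_p]
  exact mul_le_of_le_one_right (by positivity) (PadicInt.norm_le_one z)

end Taylor

end MoritaGamma

end

/-! ### The radii and the size of `g₀` for Morita's Gamma function. -/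

theorem theorem7p2p1 (p : ℕ) [Fact p.Prime] (hp : p ≠ 2) :
    ∃ (Y g₀ : ℚ_[p]⟦X⟧),
      IsTaylorExpansionAtZero (moritaGamma p) Y ∧
      IsAnalyticOnDisc g₀ 1 ∧
      PowerSeries.derivative ℚ_[p] Y = g₀ * Y ∧
      -- the radius of convergence at `x_{0,ρ}`
      (∀ (ρ : ℝ), 0 ≤ ρ → ∀ (Ω : Type*) [NormedField Ω] [NormedAlgebra ℚ_[p] Ω]
        [IsUltrametricDist Ω] [CompleteSpace Ω] (t : Ω), LiesOver (K := ℚ_[p]) t ρ →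
        (ρ ≤ breakRadius p 0 →
          IsRadiusAt g₀ t (omega p * absP p ^ (1 / (p : ℝ)))) ∧
        (∀ n : ℕ, 1 ≤ n → breakRadius p (n - 1) ≤ ρ → ρ ≤ breakRadius p n →
          IsRadiusAt g₀ t (omega p * absP p ^ n / ρ ^ (p ^ (n - 1) * (p - 1))))) ∧
      -- the absolute value of `g₀` at `x_{0,ρ}`
      (∀ (ρ : ℝ), 0 < ρ → ρ ≤ breakRadius p 0 → gaussPoint ρ g₀ ≤ ρ⁻¹) ∧
      (∀ (ρ : ℝ) (n : ℕ), 1 ≤ n → breakRadius p (n - 1) ≤ ρ → ρ ≤ breakRadius p n →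
        gaussPoint ρ g₀ = ρ ^ (p ^ (n - 1) * (p - 1)) / absP p ^ n) := by
  have hp3 : 3 ≤ p := by
    have := (Fact.out : p.Prime).two_le
    omega
  have hp0 : (0 : ℝ) < p := by exact_mod_cast (Fact.out : p.Prime).pos
  obtain ⟨g, hg, hY⟩ := exists_isTaylorExpansionAtZero_odeSol hp3
  refine ⟨odeSol g, g, hY, hg.isAnalyticOnDisc, derivative_odeSol g, ?_,
    fun ρ hρ h => hg.gaussPoint_le hp3 hρ h, ?_⟩
  · intro ρ hρ Ω _ _ _ _ t ht
    refine ⟨fun h => hg.isRadiusAt_of_le hp3 hρ ht h, fun n hn hlow hupp => ?_⟩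
    obtain ⟨N, rfl⟩ : ∃ N, n = N + 1 := ⟨n - 1, by omega⟩
    rw [Nat.add_sub_cancel] at hlow ⊢
    have := hg.isRadiusAt hp3 ht hlow hupp
    rwa [← div_div, div_eq_mul_inv (omega p), ← inv_pow, ← absP_eq] at this
  · intro ρ n hn hlow hupp
    obtain ⟨N, rfl⟩ : ∃ N, n = N + 1 := ⟨n - 1, by omega⟩
    rw [Nat.add_sub_cancel] at hlow ⊢
    rw [hg.gaussPoint_eq hp3 hlow hupp, absP_eq, inv_pow, div_inv_eq_mul, mul_comm]
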